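/- Let $\mathbb T^3=\mathbb R^3/(2\mathbb Z)^3$ be the flat torus, let $\kappa$ be a constant (the conductivity of the isotropic base material), and let $\boldsymbol p\in\mathbb R^3$ be a constant vector. Let $\tilde\omega(t)\subset\mathbb T^3$, $t\in(t_1,t_2)$, be a smooth family of closed embedded smooth surfaces, $\tilde\omega(t)=r(t,M)$ with $M$ a compact smooth $2$-manifold and $r$ smooth in $(t,x)$. For each $t$ let $\boldsymbol p_{\tilde\omega(t)}$ be the tangential component of $\boldsymbol p$ on $\tilde\omega(t)$, and let $\bar u(t)\in H^1(\tilde\omega(t))$ be the weak solution (determined up to additive constants on the components) of $\Delta\bar u=-\operatorname{div}\boldsymbol p_{\tilde\omega(t)}$ on $\tilde\omega(t)$, that is, $$\int_{\tilde\omega(t)}(\nabla\bar u+\boldsymbol p_{\tilde\omega(t)})\cdot\nabla v=0\qquad\text{for all }v\in H^1(\tilde\omega(t)).$$ Put $$I_a^c(t)=\int_{\tilde\omega(t)}\kappa\,(\nabla\bar u+\boldsymbol p_{\tilde\omega(t)})\cdot(\nabla\bar u+\boldsymbol p_{\tilde\omega(t)}).$$ Suppose that at a time $t_0\in(t_1,t_2)$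 the velocity of the family is normal, $\partial_t r(t_0,\cdot)=v_n\boldsymbol n$, where $\boldsymbol n$ is a unit normal field of $\tilde\omega=\tilde\omega(t_0)$ and $v_n:\tilde\omega\to\mathbb R$. Then $I_a^c$ is differentiable at $t_0$ (no differentiability of $\bar u$ in $t$ being assumed), and $$\dot I_a^c(t_0)=\int_{\tilde\omega}2v_n\,\kappa\,(\boldsymbol b-H\boldsymbol I)(\nabla\bar u+\boldsymbol p_{\tilde\omega})\cdot(\nabla\bar u+\boldsymbol p_{\tilde\omega}),$$ where the integrand is integrable, $\bar u=\bar u(t_0)$, $\boldsymbol b$ is the second fundamental form, $b_{\alpha\beta}=\boldsymbol n\cdot\partial_\beta\boldsymbol a_\alpha$ with $\boldsymbol a_\alpha=\partial_\alpha r(t_0,\cdot)$, $H=\tfrac12 a^{\alpha\beta}b_{\alpha\beta}$ is the mean curvature, with $(a^{\alpha\beta})$ the inverse of the first fundamental form $a_{\alpha\beta}=\boldsymbol a_\alpha\cdot\boldsymbol a_\beta$, and $\boldsymbol I$ is the identity. -/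

import Mathlib

open Set Filter Topology MeasureTheory
open scoped Manifold ContDiff

namespace ADC

noncomputable section

/-- The parameter plane `ℝ²`. -/
abbrev E2 : Type := EuclideanSpace ℝ (Fin 2)

/-- The ambient space `ℝ³` with its Euclidean structure; it is also every tangent space of the
flat torus. -/
abbrev E3 : Type := EuclideanSpace ℝ (Fin 3)

/-- The flat torus `𝕋³ = ℝ³ / (2ℤ)³`. -/
abbrev T3 : Type := Fin 3 → AddCircle (2 : ℝ)

instance factTwoPos : Fact ((0 : ℝ) < 2) := ⟨two_pos⟩

/-- The inverse of the covering `ℝ³ → 𝕋³` near `q`, normalised by `lift q q = 0`: the unique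
representative of `z - q` in `[-1, 1)³`. It is a local isometry near `q`, and for two base points
the two lifts differ locally by a constant, so derivatives taken through it do not depend on the
base point. -/
def lift (q z : T3) : E3 :=
  WithLp.toLp 2 fun i => ((AddCircle.equivIco (2 : ℝ) (-1) (z i - q i) : Ico (-1 : ℝ) (-1 + 2)) : ℝ)

/-- The standard basis of the parameter plane. -/
def e (α : Fin 2) : E2 := EuclideanSpace.single α 1

section Geometry

variable {M : Type*} [TopologicalSpace M] [ChartedSpace E2 M]

/-- The map `f` in the chart at `c`, lifted to `ℝ³` near the point `x`. -/
def localRep (f : M → T3) (c x : M) : E2 → E3 :=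
  fun y => lift (f x) (f ((chartAt E2 c).symm y))

/-- The covariant basis vector `a_α = ∂_α r` at `x`, in the chart at `c`. -/
def basisVec (f : M → T3) (c x : M) (α : Fin 2) : E3 :=
  fderiv ℝ (localRep f c x) (chartAt E2 c x) (e α)

/-- The first fundamental form `a_{αβ} = a_α · a_β` at `x`, in the chart at `c`. -/
def metric (f : M → T3) (c x : M) : Matrix (Fin 2) (Fin 2) ℝ :=
  Matrix.of fun α β => inner ℝ (basisVec f c x α) (basisVec f c x β)

/-- The second fundamental form `b_{αβ} = n · ∂_β a_α` at `x`, in the chart at `c`. -/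
def secondForm (f : M → T3) (n : M → E3) (c x : M) : Matrix (Fin 2) (Fin 2) ℝ :=
  Matrix.of fun α β => inner ℝ (n x)
    (fderiv ℝ (fun y => fderiv ℝ (localRep f c x) y (e α)) (chartAt E2 c x) (e β))

/-- The contravariant components `w^α = a^{αβ} (w · a_β)` of a tangent vector `w` at `x`, in the
chart at `x`. -/
def contra (f : M → T3) (x : M) (w : E3) (α : Fin 2) : ℝ :=
  ∑ β, (metric f x x)⁻¹ α β * inner ℝ w (basisVec f x x β)

/-- The quadratic form `(b w) · w = b_{αβ} w^α w^β` of a tangent vector `w` at `x`. -/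
def secondFormQuad (f : M → T3) (n : M → E3) (x : M) (w : E3) : ℝ :=
  ∑ α, ∑ β, secondForm f n x x α β * contra f x w α * contra f x w β

/-- The mean curvature `H = (1/2) a^{αβ} b_{αβ}`. -/
def meanCurv (f : M → T3) (n : M → E3) (x : M) : ℝ :=
  (1 / 2) * ∑ α, ∑ β, (metric f x x)⁻¹ α β * secondForm f n x x α β

/-- The tangent plane of the surface at `x`, as a subspace of `ℝ³`. -/
def tangentPlane (f : M → T3) (x : M) : Submodule ℝ E3 :=
  Submodule.span ℝ (Set.range (basisVec f x x))

/-- The tangential component of the constant vector `p` at `x`. -/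
def tangentPart (f : M → T3) (p : E3) (x : M) : E3 :=
  (tangentPlane f x).starProjection p

/-- `n` is a field of unit normals of the surface. -/
def IsUnitNormal (f : M → T3) (n : M → E3) : Prop :=
  ∀ x, ‖n x‖ = 1 ∧ ∀ w ∈ tangentPlane f x, inner ℝ (n x) w = 0

/-- `f` is a smooth injective immersion into the torus; for compact `M` this is a smooth
embedding. -/
structure IsEmbeddedSurface (f : M → T3) : Prop where
  smooth : ∀ x, ContMDiffAt (𝓡 2) 𝓘(ℝ, E3) ∞ (fun y => lift (f x) (f y)) x
  injective : Function.Injective f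
  immersion : ∀ x, LinearIndependent ℝ (basisVec f x x)

/-- `r t x` is smooth jointly in the time `t ∈ J` and the point `x`. -/
def IsSmoothFamily (J : Set ℝ) (r : ℝ → M → T3) : Prop :=
  ∀ t ∈ J, ∀ x, ContMDiffAt (𝓘(ℝ, ℝ).prod (𝓡 2)) 𝓘(ℝ, E3) ∞
    (fun z : ℝ × M => lift (r t x) (r z.1 z.2)) (t, x)

end Geometry

/-! A finite partition of the compact surface into patches, each relatively compact in the domain
of a chart. The partition is chosen once for the abstract surface `M`; the area measure does not
depend on it, by the change of variables formula. -/

section Partition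

variable {M : Type*} [TopologicalSpace M] [ChartedSpace E2 M]

theorem exists_discRadius (c : M) :
    ∃ ρ : ℝ, 0 < ρ ∧ Metric.closedBall (chartAt E2 c c) ρ ⊆ (chartAt E2 c).target := by
  have h : (chartAt E2 c).target ∈ 𝓝 (chartAt E2 c c) :=
    (chartAt E2 c).open_target.mem_nhds ((chartAt E2 c).map_source (mem_chart_source E2 c))
  exact Metric.nhds_basis_closedBall.mem_iff.1 h

/-- The radius of a coordinate disc around `c`. -/
def discRadius (c : M) : ℝ := (exists_discRadius c).choose

/-- A coordinate disc around `c`. -/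
def disc (c : M) : Set M :=
  (chartAt E2 c).source ∩ chartAt E2 c ⁻¹' Metric.ball (chartAt E2 c c) (discRadius c)

theorem exists_centers (M : Type*) [TopologicalSpace M] [ChartedSpace E2 M] [CompactSpace M] :
    ∃ (N : ℕ) (c : Fin N → M), (⋃ i, disc (c i)) = univ := by
  have hnhds : ∀ c ∈ (univ : Set M), disc c ∈ 𝓝 c := fun c _ =>
    ((chartAt E2 c).isOpen_inter_preimage Metric.isOpen_ball).mem_nhds
      ⟨mem_chart_source E2 c, Metric.mem_ball_self (exists_discRadius c).choose_spec.1⟩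
  obtain ⟨s, -, hs⟩ := isCompact_univ.elim_nhds_subcover disc hnhds
  refine ⟨s.card, fun i => (s.equivFin.symm i : M), ?_⟩
  refine eq_univ_of_univ_subset fun x hx => ?_
  obtain ⟨c, hc, hxc⟩ := mem_iUnion₂.1 (hs hx)
  exact mem_iUnion.2 ⟨s.equivFin ⟨c, hc⟩, by simpa using hxc⟩

variable (M) in
/-- The number of patches. -/
def numPatches [CompactSpace M] : ℕ := (exists_centers M).choose

variable (M) in
/-- The centres of the coordinate discs. -/
def center [CompactSpace M] : Fin (numPatches M) → M := (exists_centers M).choose_spec.choose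

variable (M) in
/-- The disjoint patches. -/
def patch [CompactSpace M] (i : Fin (numPatches M)) : Set M :=
  disc (center M i) \ ⋃ j < i, disc (center M j)

end Partition

section Analysis

variable {M : Type*} [TopologicalSpace M] [ChartedSpace E2 M]

/-- The area density `√a`, `a = det (a_{αβ})`, on the parameter domain of the chart at `c`. -/
def areaDensity (f : M → T3) (c : M) (y : E2) : ℝ :=
  Real.sqrt (metric f c ((chartAt E2 c).symm y)).det

/-- The area measure of the surface, `√a dy¹ dy²` on each patch. -/
def area [CompactSpace M] [MeasurableSpace M] (f : M → T3) : Measure M :=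
  ∑ i, Measure.map (chartAt E2 (center M i)).symm
    ((volume.restrict (chartAt E2 (center M i) '' patch M i)).withDensity
      fun y => ENNReal.ofReal (areaDensity f (center M i) y))

/-- The tangential field `G` is the weak surface gradient of `u`: in every chart, `G · a_α` is the
weak partial derivative `∂_α u`. -/
structure IsWeakGradient (f : M → T3) (u : M → ℝ) (G : M → E3) : Prop where
  tangential : ∀ x, G x ∈ tangentPlane f x
  locInt : ∀ c : M, LocallyIntegrableOn (fun y => u ((chartAt E2 c).symm y))
    (chartAt E2 c).target volume
  locIntGrad : ∀ (c : M) (α : Fin 2), LocallyIntegrableOn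
    (fun y => inner ℝ (G ((chartAt E2 c).symm y)) (basisVec f c ((chartAt E2 c).symm y) α))
    (chartAt E2 c).target volume
  byParts : ∀ (c : M) (α : Fin 2) (ψ : E2 → ℝ), ContDiff ℝ ∞ ψ → HasCompactSupport ψ →
    tsupport ψ ⊆ (chartAt E2 c).target →
    ∫ y in (chartAt E2 c).target, u ((chartAt E2 c).symm y) * fderiv ℝ ψ y (e α) =
      -∫ y in (chartAt E2 c).target,
        inner ℝ (G ((chartAt E2 c).symm y)) (basisVec f c ((chartAt E2 c).symm y) α) * ψ y

/-- `u` belongs to `H¹` of the surface, with weak gradient `G`. -/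
structure IsH1 [CompactSpace M] [MeasurableSpace M] (f : M → T3) (u : M → ℝ) (G : M → E3) :
    Prop where
  weakGradient : IsWeakGradient f u G
  memLp : MemLp u 2 (area f)
  memLpGrad : MemLp G 2 (area f)

/-- `u ∈ H¹`, with weak gradient `G = ∇u`, is a weak solution of `Δ u = - div p_tan` on the
surface: `∫ (∇u + p_tan) · ∇v = 0` for all `v ∈ H¹`. -/
def IsWeakSolution [CompactSpace M] [MeasurableSpace M] (f : M → T3) (p : E3)
    (u : M → ℝ) (G : M → E3) : Prop :=
  IsH1 f u G ∧ ∀ (v : M → ℝ) (Gv : M → E3), IsH1 f v Gv →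
    ∫ x, inner ℝ (G x + tangentPart f p x) (Gv x) ∂(area f) = 0

/-- The integral `∫ κ (∇u + p_tan) · (∇u + p_tan)` over the surface, where `G = ∇u`. -/
def numerator [CompactSpace M] [MeasurableSpace M] (κ : ℝ) (p : E3) (f : M → T3) (G : M → E3) :
    ℝ :=
  ∫ x, κ * inner ℝ (G x + tangentPart f p x) (G x + tangentPart f p x) ∂(area f)

/-- The integrand `2 v κ (b - H I) w · w`, where `w = ∇u + p_tan` and `G = ∇u`. -/
def sensitivityDensity (κ : ℝ) (p : E3) (f : M → T3) (n : M → E3) (v : M → ℝ) (G : M → E3)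
    (x : M) : ℝ :=
  2 * v x * κ * (secondFormQuad f n x (G x + tangentPart f p x) -
    meanCurv f n x * inner ℝ (G x + tangentPart f p x) (G x + tangentPart f p x))

end Analysis

end

end ADC

/-!
The energy of the solution is the minimum of a quadratic functional of `1`-forms, and the derivative
of a minimum is the partial derivative of the functional at the fixed minimiser.

All surfaces are parametrised by the same `M`. A vector field on one of them is encoded by the
`1`-form on `M` whose components are its products with the coordinate vectors, and `transfer` is the
resulting bundle map between two surfaces. It preserves weak gradients (`IsH1.transfer`), so `H¹` is
one space for all times. The area measures differ by the density `areaRatio`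
(`area_eq_withDensity`). The energy at the time `t` therefore becomes a quadratic form
`Q_t(W) = ∫ W · energyForm W` on fields over the surface at the time `t₀`, Lipschitz in `t`
uniformly on `M` (`IsSmoothFamily.exists_lipschitz_energyForm`).

Let `W_t` be the field over the surface at `t₀` that represents `∇u + p_tan` at the time `t`. The
`1`-forms induced by the constant vector `p` at the times `t` and `t₀` differ by the differential of
the displacement in the direction `p`, a smooth function on `M` as long as `t` is close to `t₀`
(`isH1_displacement`). Hence `D = W_t - W_{t₀}` is a gradient, and the two weak equations read
`Q_t(W_t, D) = 0` and `Q_{t₀}(W_{t₀}, D) = 0`. They give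
`Q_t(W_t) = Q_t(W_{t₀}) - Q_t(D)` and `Q_t(D) = (Q_{t₀} - Q_t)(W_{t₀}, D)`, so that `D` is of order
`t - t₀` in `L²` and `Q_t(W_t) = Q_t(W_{t₀}) + O((t - t₀)²)` (`abs_energy_sub_le`). No
differentiability of the solution in time enters.

It remains to differentiate `Q_t` at a fixed field, under the integral sign. For a normal velocity
`v n` the product `v n · a_α` vanishes identically, and its derivative along the surface gives
`∂_t a_{αβ} = -2 v b_{αβ}` (`IsSmoothFamily.hasDerivAt_metric`); the derivative of `√a a^{αβ}` is
then `2 v √a (b^{αβ} - H a^{αβ})` (`IsSmoothFamily.hasDerivAt_energyForm`).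
-/

namespace ADC

noncomputable section

/-! ### Lifting the torus -/

section Lift

theorem lift_eq_of_coe {q z : T3} {w : E3} (hw : ∀ i, w i ∈ Ico (-1 : ℝ) 1)
    (h : ∀ i, ((w i : ℝ) : AddCircle (2 : ℝ)) = z i - q i) : lift q z = w := by
  ext i
  have h1 : w i ∈ Ico (-1 : ℝ) (-1 + 2) := by
    have := hw i
    norm_num at this ⊢
    exact this
  simp only [lift, ← h i]
  rw [AddCircle.equivIco_coe_eq h1]

theorem coe_lift (q z : T3) (i : Fin 3) :
    ((lift q z i : ℝ) : AddCircle (2 : ℝ)) = z i - q i := by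
  simp only [lift]
  exact AddCircle.coe_equivIco

theorem lift_self (q : T3) : lift q q = 0 :=
  lift_eq_of_coe (fun i => by simp) (fun i => by simp)

theorem mem_Ico_of_norm_lt {w : E3} (hw : ‖w‖ < 1) (i : Fin 3) : w i ∈ Ico (-1 : ℝ) 1 := by
  have h : |w i| < 1 := lt_of_le_of_lt (PiLp.norm_apply_le w i) hw
  exact ⟨(abs_lt.1 h).1.le, (abs_lt.1 h).2⟩

theorem lift_add {q z w : T3} (h : ‖lift q z‖ + ‖lift z w‖ < 1) :
    lift q w = lift q z + lift z w := by
  refine lift_eq_of_coe (mem_Ico_of_norm_lt ((norm_add_le _ _).trans_lt h)) fun i => ?_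
  rw [PiLp.add_apply, AddCircle.coe_add, coe_lift, coe_lift]
  abel

theorem lift_comm {q z : T3} (h : ‖lift q z‖ < 1) : lift z q = -lift q z := by
  refine lift_eq_of_coe (mem_Ico_of_norm_lt (by rwa [norm_neg])) fun i => ?_
  rw [PiLp.neg_apply, AddCircle.coe_neg, coe_lift]
  abel

/-- Two points near `q` may be compared through the lift based at `q`. The bound excludes the cut of
the lift. -/
theorem lift_sub {q z w : T3} (h : ‖lift q z‖ + ‖lift q w‖ < 1) :
    lift z w = lift q w - lift q z := by
  have h1 : lift z q = -lift q z := lift_comm (by linarith [norm_nonneg (lift q w)])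
  rw [lift_add (z := q) (by rwa [h1, norm_neg]), h1]
  abel

end Lift

/-! ### Coordinate frames -/

section Regularity

variable {M : Type*} [TopologicalSpace M] [ChartedSpace E2 M]

/-- The family `r` near `r t₀ x₀`, lifted to `ℝ³` with one base point for all times, in the chart
at `c`. -/
def jointRep (r : ℝ → M → T3) (t₀ : ℝ) (c x₀ : M) : ℝ × E2 → E3 :=
  fun z => lift (r t₀ x₀) (r z.1 ((chartAt E2 c).symm z.2))

theorem IsSmoothFamily.tendsto_lift {J : Set ℝ} {r : ℝ → M → T3} (hr : IsSmoothFamily J r)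
    {t₀ : ℝ} (ht : t₀ ∈ J) (x₀ : M) :
    Tendsto (fun z : ℝ × M => lift (r t₀ x₀) (r z.1 z.2)) (𝓝 (t₀, x₀)) (𝓝 0) := by
  have h := (hr t₀ ht x₀).continuousAt
  simpa [ContinuousAt, lift_self] using h

theorem IsEmbeddedSurface.isSmoothFamily {f : M → T3} (hf : IsEmbeddedSurface f) :
    IsSmoothFamily univ (fun _ => f) := fun t _ x =>
  ContMDiffAt.comp (t, x) (g := fun y => lift (f x) (f y)) (hf.smooth x)
    (contMDiffAt_snd (I := 𝓘(ℝ, ℝ)) (J := 𝓡 2))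

theorem IsSmoothFamily.contDiffAt_jointRep [IsManifold (𝓡 2) ∞ M] {J : Set ℝ} {r : ℝ → M → T3}
    (hr : IsSmoothFamily J r) {t₀ : ℝ} (ht : t₀ ∈ J) {c x₀ : M}
    (hx : x₀ ∈ (chartAt E2 c).source) :
    ContDiffAt ℝ ∞ (jointRep r t₀ c x₀) (t₀, chartAt E2 c x₀) := by
  rw [← contMDiffAt_iff_contDiffAt, modelWithCornersSelf_prod, ← chartedSpaceSelf_prod]
  have h1 : ContMDiffAt (𝓡 2) (𝓡 2) ∞ (chartAt E2 c).symm (chartAt E2 c x₀) :=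
    (contMDiffOn_chart_symm (I := 𝓡 2) (n := ∞) (x := c)).contMDiffAt
      ((chartAt E2 c).open_target.mem_nhds ((chartAt E2 c).map_source hx))
  have h2 : ContMDiffAt (𝓘(ℝ, ℝ).prod (𝓡 2)) (𝓘(ℝ, ℝ).prod (𝓡 2)) ∞
      (fun z : ℝ × E2 => (z.1, (chartAt E2 c).symm z.2)) (t₀, chartAt E2 c x₀) :=
    contMDiffAt_fst.prodMk (h1.comp (t₀, chartAt E2 c x₀) contMDiffAt_snd)
  have h3 := hr t₀ ht x₀
  rw [← (chartAt E2 c).left_inv hx] at h3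
  have h4 := ContMDiffAt.comp (t₀, chartAt E2 c x₀) (g := fun z : ℝ × M =>
    lift (r t₀ ((chartAt E2 c).symm (chartAt E2 c x₀))) (r z.1 z.2)) h3 h2
  rw [(chartAt E2 c).left_inv hx] at h4
  exact h4

/-- The base point of the lift may be frozen: near `(t₀, x₀)` the local representations at
all nearby times and points differ from one joint representation by constants. -/
theorem IsSmoothFamily.eventually_localRep {J : Set ℝ} {r : ℝ → M → T3}
    (hr : IsSmoothFamily J r) {t₀ : ℝ} (ht : t₀ ∈ J) {c x₀ : M}
    (hx : x₀ ∈ (chartAt E2 c).source) :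
    ∀ᶠ z : ℝ × M in 𝓝 (t₀, x₀), z.2 ∈ (chartAt E2 c).source ∧
      localRep (r z.1) c z.2 =ᶠ[𝓝 (chartAt E2 c z.2)]
        fun y => jointRep r t₀ c x₀ (z.1, y) - lift (r t₀ x₀) (r z.1 z.2) := by
  have h1 : ∀ᶠ z : ℝ × M in 𝓝 (t₀, x₀), ‖lift (r t₀ x₀) (r z.1 z.2)‖ < 1 / 2 := by
    have := (hr.tendsto_lift ht x₀).norm
    rw [norm_zero] at this
    exact this.eventually (gt_mem_nhds (by norm_num))
  have h2 : ∀ᶠ z : ℝ × M in 𝓝 (t₀, x₀), z.2 ∈ (chartAt E2 c).source :=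
    continuousAt_snd.eventually ((chartAt E2 c).open_source.mem_nhds hx)
  filter_upwards [eventually_eventually_nhds.2 h1, h2] with z hz hz2
  refine ⟨hz2, ?_⟩
  have h3 : Tendsto (fun y : E2 => (z.1, (chartAt E2 c).symm y)) (𝓝 (chartAt E2 c z.2)) (𝓝 z) := by
    have h4 := (chartAt E2 c).continuousAt_symm ((chartAt E2 c).map_source hz2)
    have h5 : ContinuousAt (fun y : E2 => (z.1, (chartAt E2 c).symm y)) (chartAt E2 c z.2) :=
      continuousAt_const.prodMk h4
    simpa [ContinuousAt, (chartAt E2 c).left_inv hz2] using h5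
  filter_upwards [h3.eventually hz] with y hy
  have h6 := hz.self_of_nhds
  simp only [localRep, jointRep]
  exact lift_sub (by linarith)

/-- The `α`-th coordinate derivative of a map of time and the parameter plane. -/
def partialDeriv (F : ℝ × E2 → E3) (α : Fin 2) (z : ℝ × E2) : E3 :=
  fderiv ℝ F z (0, e α)

theorem contDiffAt_partialDeriv {F : ℝ × E2 → E3} {z : ℝ × E2} (hF : ContDiffAt ℝ ∞ F z)
    (α : Fin 2) : ContDiffAt ℝ ∞ (partialDeriv F α) z :=
  (hF.fderiv_right (m := ∞) (by simp)).clm_apply contDiffAt_const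

theorem hasFDerivAt_slice {F : ℝ × E2 → E3} {t : ℝ} {y : E2} (hF : DifferentiableAt ℝ F (t, y)) :
    HasFDerivAt (fun y => F (t, y)) ((fderiv ℝ F (t, y)).comp (ContinuousLinearMap.inr ℝ ℝ E2)) y :=
  hF.hasFDerivAt.comp y (hasFDerivAt_prodMk_right t y)

theorem IsSmoothFamily.eventually_hasFDerivAt [IsManifold (𝓡 2) ∞ M] {J : Set ℝ} {r : ℝ → M → T3}
    (hr : IsSmoothFamily J r) {t₀ : ℝ} (ht : t₀ ∈ J) {c x₀ : M}
    (hx : x₀ ∈ (chartAt E2 c).source) :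
    ∀ᶠ z : ℝ × M in 𝓝 (t₀, x₀), HasFDerivAt (localRep (r z.1) c z.2)
      ((fderiv ℝ (jointRep r t₀ c x₀) (z.1, chartAt E2 c z.2)).comp
        (ContinuousLinearMap.inr ℝ ℝ E2)) (chartAt E2 c z.2) := by
  have hc : ContinuousAt (fun z : ℝ × M => (z.1, chartAt E2 c z.2)) (t₀, x₀) :=
    continuousAt_fst.prodMk
      (ContinuousAt.comp (x := (t₀, x₀)) ((chartAt E2 c).continuousAt hx) continuousAt_snd)
  have hd := ((hr.contDiffAt_jointRep ht hx).of_le (m := 1) (by simp)).eventually (by simp)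
  filter_upwards [hr.eventually_localRep ht hx, hc.eventually hd] with z hz hz2
  exact ((hasFDerivAt_slice (hz2.differentiableAt (by simp))).sub_const _).congr_of_eventuallyEq
    hz.2

theorem IsSmoothFamily.eventually_basisVec [IsManifold (𝓡 2) ∞ M] {J : Set ℝ} {r : ℝ → M → T3}
    (hr : IsSmoothFamily J r) {t₀ : ℝ} (ht : t₀ ∈ J) {c x₀ : M}
    (hx : x₀ ∈ (chartAt E2 c).source) :
    ∀ᶠ z : ℝ × M in 𝓝 (t₀, x₀), ∀ α, basisVec (r z.1) c z.2 α =
      partialDeriv (jointRep r t₀ c x₀) α (z.1, chartAt E2 c z.2) := by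
  filter_upwards [hr.eventually_hasFDerivAt ht hx] with z hz α
  rw [basisVec, hz.fderiv]
  rfl

theorem IsEmbeddedSurface.differentiableAt_localRep [IsManifold (𝓡 2) ∞ M] {f : M → T3}
    (hf : IsEmbeddedSurface f) {c x : M} (hx : x ∈ (chartAt E2 c).source) :
    DifferentiableAt ℝ (localRep f c x) (chartAt E2 c x) :=
  (hf.isSmoothFamily.eventually_hasFDerivAt
    (mem_univ (0 : ℝ)) hx).self_of_nhds.differentiableAt

theorem IsEmbeddedSurface.continuousAt_basisVec [IsManifold (𝓡 2) ∞ M] {f : M → T3}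
    (hf : IsEmbeddedSurface f) {c x : M} (hx : x ∈ (chartAt E2 c).source) (α : Fin 2) :
    ContinuousAt (fun x => basisVec f c x α) x := by
  have h1 := hf.isSmoothFamily.eventually_basisVec (mem_univ (0 : ℝ)) hx
  have hg : ContinuousAt (fun x' : M => ((0 : ℝ), x')) x :=
    continuousAt_const.prodMk continuousAt_id
  have h2 := hg.eventually h1
  have h3 := (contDiffAt_partialDeriv
    (hf.isSmoothFamily.contDiffAt_jointRep (mem_univ (0 : ℝ)) hx) α).continuousAt
  have h4 : ContinuousAt (fun x' : M => ((0 : ℝ), chartAt E2 c x')) x :=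
    continuousAt_const.prodMk ((chartAt E2 c).continuousAt hx)
  refine (ContinuousAt.comp (f := fun x' : M => ((0 : ℝ), chartAt E2 c x')) h3 h4).congr ?_
  filter_upwards [h2] with x' hx'
  exact (hx' α).symm

/-- The derivative of the transition from the chart at `c` to the chart at `c'`. -/
def jacobian (c c' x : M) : Matrix (Fin 2) (Fin 2) ℝ :=
  Matrix.of fun α β =>
    fderiv ℝ (fun y => chartAt E2 c' ((chartAt E2 c).symm y)) (chartAt E2 c x) (e α) β

theorem eq_sum_e (w : E2) : w = ∑ β, w β • e β := by
  ext i
  fin_cases i <;> simp [e]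

theorem differentiableAt_transition [IsManifold (𝓡 2) ∞ M] {c c' x : M}
    (hc : x ∈ (chartAt E2 c).source) (hc' : x ∈ (chartAt E2 c').source) :
    DifferentiableAt ℝ (fun y => chartAt E2 c' ((chartAt E2 c).symm y)) (chartAt E2 c x) := by
  have h1 : ContMDiffAt (𝓡 2) (𝓡 2) ∞ (chartAt E2 c).symm (chartAt E2 c x) :=
    (contMDiffOn_chart_symm (I := 𝓡 2) (n := ∞) (x := c)).contMDiffAt
      ((chartAt E2 c).open_target.mem_nhds ((chartAt E2 c).map_source hc))
  have h2 : ContMDiffAt (𝓡 2) (𝓡 2) ∞ (chartAt E2 c') x :=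
    (contMDiffOn_chart (I := 𝓡 2) (n := ∞) (x := c')).contMDiffAt
      ((chartAt E2 c').open_source.mem_nhds hc')
  rw [← (chartAt E2 c).left_inv hc] at h2
  exact (contMDiffAt_iff_contDiffAt.1 (h2.comp (chartAt E2 c x) h1)).differentiableAt (by simp)

/-- The coordinate frames in two charts are related by the Jacobian of the transition, which is
the same for all surfaces. -/
theorem IsEmbeddedSurface.basisVec_eq_sum [IsManifold (𝓡 2) ∞ M] {f : M → T3}
    (hf : IsEmbeddedSurface f) {c c' x : M}
    (hc : x ∈ (chartAt E2 c).source) (hc' : x ∈ (chartAt E2 c').source) (α : Fin 2) :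
    basisVec f c x α = ∑ β, jacobian c c' x α β • basisVec f c' x β := by
  have h1 : localRep f c x =ᶠ[𝓝 (chartAt E2 c x)]
      localRep f c' x ∘ fun y => chartAt E2 c' ((chartAt E2 c).symm y) := by
    have h2 := (chartAt E2 c).continuousAt_symm ((chartAt E2 c).map_source hc)
    have h3 : ∀ᶠ y in 𝓝 (chartAt E2 c x), (chartAt E2 c).symm y ∈ (chartAt E2 c').source := by
      refine h2.eventually ((chartAt E2 c').open_source.mem_nhds ?_)
      rwa [(chartAt E2 c).left_inv hc]
    filter_upwards [h3] with y hy
    simp [localRep, (chartAt E2 c').left_inv hy]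
  have h4 := hf.differentiableAt_localRep hc'
  rw [← (chartAt E2 c).left_inv hc] at h4
  have h5 : DifferentiableAt ℝ (localRep f c' x)
      ((fun y => chartAt E2 c' ((chartAt E2 c).symm y)) (chartAt E2 c x)) := by
    simpa [(chartAt E2 c).left_inv hc] using h4
  rw [basisVec, h1.fderiv_eq, fderiv_comp (chartAt E2 c x) h5 (differentiableAt_transition hc hc'),
    ContinuousLinearMap.comp_apply,
    eq_sum_e (fderiv ℝ (fun y => chartAt E2 c' ((chartAt E2 c).symm y)) (chartAt E2 c x) (e α)),
    map_sum]
  simp only [map_smul, (chartAt E2 c).left_inv hc]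
  rfl

theorem jacobian_mul [IsManifold (𝓡 2) ∞ M] {c c' x : M}
    (hc : x ∈ (chartAt E2 c).source) (hc' : x ∈ (chartAt E2 c').source) :
    jacobian c c' x * jacobian c' c x = 1 := by
  set φ := fun y => chartAt E2 c' ((chartAt E2 c).symm y)
  set φ' := fun y => chartAt E2 c ((chartAt E2 c').symm y)
  have hφx : φ (chartAt E2 c x) = chartAt E2 c' x := by simp [φ, (chartAt E2 c).left_inv hc]
  have h1 : φ' ∘ φ =ᶠ[𝓝 (chartAt E2 c x)] id := by
    have h2 := (chartAt E2 c).continuousAt_symm ((chartAt E2 c).map_source hc)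
    have h3 : ∀ᶠ y in 𝓝 (chartAt E2 c x), (chartAt E2 c).symm y ∈ (chartAt E2 c').source := by
      refine h2.eventually ((chartAt E2 c').open_source.mem_nhds ?_)
      rwa [(chartAt E2 c).left_inv hc]
    filter_upwards [h3, (chartAt E2 c).open_target.mem_nhds ((chartAt E2 c).map_source hc)]
      with y hy hy'
    simp [φ, φ', (chartAt E2 c').left_inv hy, (chartAt E2 c).right_inv hy']
  have h4 : DifferentiableAt ℝ φ' (φ (chartAt E2 c x)) := by
    rw [hφx]; exact differentiableAt_transition hc' hc
  have h5 := h1.fderiv_eq (𝕜 := ℝ)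
  rw [fderiv_comp _ h4 (differentiableAt_transition hc hc'), hφx, fderiv_id] at h5
  ext α β
  have h6 : fderiv ℝ φ' (chartAt E2 c' x) (fderiv ℝ φ (chartAt E2 c x) (e α)) = e α :=
    congrArg (fun A : E2 →L[ℝ] E2 => A (e α)) h5
  rw [eq_sum_e (fderiv ℝ φ (chartAt E2 c x) (e α)), map_sum] at h6
  have h7 := congrArg (fun w : E2 => w β) h6
  simp only [map_smul] at h7
  rw [Matrix.mul_apply]
  simp only [jacobian, Matrix.of_apply]
  simp only [Fin.sum_univ_two, PiLp.add_apply, PiLp.smul_apply, smul_eq_mul] at h7 ⊢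
  rw [h7]
  fin_cases α <;> fin_cases β <;> simp [e]

end Regularity

/-! ### Transport of `1`-forms between surfaces -/

section Frames

/-- For two frames `a`, `b` of planes in `ℝ³`, the linear map `w ↦ ∑ b^{αβ} (w · a_α) b_β`. It sends
`w` to the vector of the second plane whose covariant components with respect to `b` are those of
`w` with respect to `a`. -/
def frameTransfer (a b : Fin 2 → E3) : E3 →L[ℝ] E3 :=
  ∑ α, ∑ β, (Matrix.gram ℝ b)⁻¹ α β • (innerSL ℝ (a α)).smulRight (b β)

theorem frameTransfer_apply (a b : Fin 2 → E3) (w : E3) :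
    frameTransfer a b w = ∑ α, ∑ β, ((Matrix.gram ℝ b)⁻¹ α β * inner ℝ (a α) w) • b β := by
  simp [frameTransfer, Fin.sum_univ_two, smul_smul]

theorem gram_inv_apply_symm (b : Fin 2 → E3) (α β : Fin 2) :
    (Matrix.gram ℝ b)⁻¹ α β = (Matrix.gram ℝ b)⁻¹ β α := by
  have h := (Matrix.isHermitian_gram ℝ b).inv
  simpa using congrFun (congrFun h β) α

theorem sum_gram_inv_mul {b : Fin 2 → E3} (hb : LinearIndependent ℝ b) (α γ : Fin 2) :
    ∑ β, (Matrix.gram ℝ b)⁻¹ α β * inner ℝ (b β) (b γ) = if α = γ then 1 else 0 := by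
  have h := Matrix.nonsing_inv_mul (Matrix.gram ℝ b)
    (Matrix.det_gram_ne_zero_iff_linearIndependent.2 hb).isUnit
  simpa [Matrix.mul_apply, Matrix.one_apply] using congrFun (congrFun h α) γ

theorem inner_frameTransfer {a b : Fin 2 → E3} (hb : LinearIndependent ℝ b) (w : E3) (γ : Fin 2) :
    inner ℝ (frameTransfer a b w) (b γ) = inner ℝ w (a γ) := by
  have h0 := sum_gram_inv_mul hb 0 γ
  have h1 := sum_gram_inv_mul hb 1 γ
  rw [frameTransfer_apply]
  simp only [Fin.sum_univ_two, inner_add_left, real_inner_smul_left] at h0 h1 ⊢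
  rw [real_inner_comm (a γ) w]
  have h2 : inner ℝ (a γ) w = (if (0 : Fin 2) = γ then 1 else 0) * inner ℝ (a 0) w +
      (if (1 : Fin 2) = γ then 1 else 0) * inner ℝ (a 1) w := by
    fin_cases γ <;> simp
  rw [h2, ← h0, ← h1]
  ring

theorem frameTransfer_mem (a b : Fin 2 → E3) (w : E3) :
    frameTransfer a b w ∈ Submodule.span ℝ (range b) := by
  rw [frameTransfer_apply]
  exact Submodule.sum_mem _ fun α _ => Submodule.sum_mem _ fun β _ =>
    Submodule.smul_mem _ _ (Submodule.subset_span (mem_range_self β))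

theorem inner_frameTransfer_frameTransfer {a b : Fin 2 → E3} (hb : LinearIndependent ℝ b)
    (ξ η : E3) : inner ℝ (frameTransfer a b ξ) (frameTransfer a b η) =
      ∑ α, ∑ β, (Matrix.gram ℝ b)⁻¹ α β * inner ℝ ξ (a α) * inner ℝ η (a β) := by
  rw [frameTransfer_apply a b η]
  simp only [inner_add_right, real_inner_smul_right, inner_frameTransfer hb, Fin.sum_univ_two]
  rw [gram_inv_apply_symm b 1 0, real_inner_comm η (a 0), real_inner_comm η (a 1)]
  ring

theorem eq_of_inner_eq {b : Fin 2 → E3} {w w' : E3} (hw : w ∈ Submodule.span ℝ (range b))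
    (hw' : w' ∈ Submodule.span ℝ (range b)) (h : ∀ α, inner ℝ w (b α) = inner ℝ w' (b α)) :
    w = w' := by
  have h1 : ∀ z ∈ Submodule.span ℝ (range b), inner ℝ (w - w') z = 0 := by
    intro z hz
    induction hz using Submodule.span_induction with
    | mem z hz => obtain ⟨α, rfl⟩ := hz; rw [inner_sub_left, h, sub_self]
    | zero => exact inner_zero_right _
    | add x y _ _ hx hy => rw [inner_add_right, hx, hy, add_zero]
    | smul c x _ hx => rw [real_inner_smul_right, hx, mul_zero]
  exact sub_eq_zero.1 (inner_self_eq_zero.1 (h1 _ (Submodule.sub_mem _ hw hw')))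

theorem continuousAt_gram {X : Type*} [TopologicalSpace X] {b : X → Fin 2 → E3} {x : X}
    (hb : ∀ α, ContinuousAt (fun x => b x α) x) :
    ContinuousAt (fun x => Matrix.gram ℝ (b x)) x :=
  continuousAt_pi.2 fun α => continuousAt_pi.2 fun β => (hb α).inner (hb β)

theorem continuousAt_gram_inv {X : Type*} [TopologicalSpace X] {b : X → Fin 2 → E3} {x : X}
    (hb : ∀ α, ContinuousAt (fun x => b x α) x) (h : LinearIndependent ℝ (b x)) :
    ContinuousAt (fun x => (Matrix.gram ℝ (b x))⁻¹) x := by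
  have h2 : ContinuousAt Ring.inverse (Matrix.gram ℝ (b x)).det := by
    rw [Ring.inverse_eq_inv']
    exact continuousAt_inv₀ (Matrix.det_gram_ne_zero_iff_linearIndependent.2 h)
  exact ContinuousAt.comp (f := fun x => Matrix.gram ℝ (b x)) (continuousAt_matrix_inv _ h2)
    (continuousAt_gram hb)

theorem continuousAt_frameTransfer {X : Type*} [TopologicalSpace X] {a b : X → Fin 2 → E3} {x : X}
    (ha : ∀ α, ContinuousAt (fun x => a x α) x) (hb : ∀ α, ContinuousAt (fun x => b x α) x)
    (h : LinearIndependent ℝ (b x)) : ContinuousAt (fun x => frameTransfer (a x) (b x)) x := by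
  unfold frameTransfer
  refine tendsto_finsetSum _ fun α _ => tendsto_finsetSum _ fun β _ => ?_
  have h3 : ContinuousAt (fun x => (Matrix.gram ℝ (b x))⁻¹ α β) x :=
    continuousAt_pi.1 (continuousAt_pi.1 (continuousAt_gram_inv hb h) α) β
  have h4 : ContinuousAt (fun x => innerSL ℝ (a x α)) x :=
    (innerSL ℝ (E := E3)).continuous.continuousAt.comp (ha α)
  have h5 : ContinuousAt (fun x => ContinuousLinearMap.smulRightL ℝ E3 E3 (innerSL ℝ (a x α))) x :=
    (ContinuousLinearMap.smulRightL ℝ E3 E3).continuous.continuousAt.comp h4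
  exact h3.smul (h5.clm_apply (hb β))

end Frames

section Transfer

variable {M : Type*} [TopologicalSpace M] [ChartedSpace E2 M]

/-- The bundle map between two surfaces parametrised by the same `M` that preserves the covariant
components of a vector, that is, the `1`-form on `M` which it represents. Its value is tangent to
`g`. -/
def transfer (f g : M → T3) (x : M) : E3 →L[ℝ] E3 :=
  frameTransfer (basisVec f x x) (basisVec g x x)

/-- The ratio of the area elements of two surfaces parametrised by the same `M`. -/
def areaRatio (f g : M → T3) (x : M) : ℝ :=
  √(metric g x x).det / √(metric f x x).det

theorem metric_eq_gram (f : M → T3) (c x : M) : metric f c x = Matrix.gram ℝ (basisVec f c x) := rfl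

theorem transfer_mem (f g : M → T3) (x : M) (w : E3) : transfer f g x w ∈ tangentPlane g x :=
  frameTransfer_mem _ _ _

variable [IsManifold (𝓡 2) ∞ M] {f g : M → T3}

theorem IsEmbeddedSurface.metric_eq_mul (hf : IsEmbeddedSurface f) {c c' x : M}
    (hc : x ∈ (chartAt E2 c).source) (hc' : x ∈ (chartAt E2 c').source) :
    metric f c x = jacobian c c' x * metric f c' x * (jacobian c c' x).transpose := by
  ext α β
  simp only [metric, Matrix.mul_apply, Matrix.of_apply, Matrix.transpose_apply,
    hf.basisVec_eq_sum hc hc', Fin.sum_univ_two, inner_add_left, inner_add_right,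
    real_inner_smul_left, real_inner_smul_right]
  ring

theorem IsEmbeddedSurface.det_metric_eq (hf : IsEmbeddedSurface f) {c c' x : M}
    (hc : x ∈ (chartAt E2 c).source) (hc' : x ∈ (chartAt E2 c').source) :
    (metric f c x).det = (jacobian c c' x).det ^ 2 * (metric f c' x).det := by
  rw [hf.metric_eq_mul hc hc', Matrix.det_mul, Matrix.det_mul, Matrix.det_transpose]
  ring

theorem det_jacobian_ne_zero {c c' x : M}
    (hc : x ∈ (chartAt E2 c).source) (hc' : x ∈ (chartAt E2 c').source) :
    (jacobian c c' x).det ≠ 0 := by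
  intro h
  have h1 := congrArg Matrix.det (jacobian_mul hc hc')
  rw [Matrix.det_mul, h, zero_mul, Matrix.det_one] at h1
  exact zero_ne_one h1

theorem IsEmbeddedSurface.det_metric_pos (hf : IsEmbeddedSurface f) {c x : M}
    (hc : x ∈ (chartAt E2 c).source) : 0 < (metric f c x).det := by
  rw [hf.det_metric_eq hc (mem_chart_source E2 x)]
  exact mul_pos (sq_pos_of_ne_zero (det_jacobian_ne_zero hc (mem_chart_source E2 x)))
    (Matrix.posDef_gram_of_linearIndependent (hf.immersion x)).det_pos

theorem IsEmbeddedSurface.linearIndependent_basisVec (hf : IsEmbeddedSurface f) {c x : M}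
    (hc : x ∈ (chartAt E2 c).source) : LinearIndependent ℝ (basisVec f c x) :=
  Matrix.det_gram_ne_zero_iff_linearIndependent.1 (hf.det_metric_pos hc).ne'

theorem IsEmbeddedSurface.span_basisVec_le (hf : IsEmbeddedSurface f) {c c' x : M}
    (hc : x ∈ (chartAt E2 c).source) (hc' : x ∈ (chartAt E2 c').source) :
    Submodule.span ℝ (range (basisVec f c x)) ≤ Submodule.span ℝ (range (basisVec f c' x)) := by
  rw [Submodule.span_le]
  rintro _ ⟨α, rfl⟩
  rw [hf.basisVec_eq_sum hc hc']
  exact Submodule.sum_mem _ fun β _ => Submodule.smul_mem _ _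
    (Submodule.subset_span (mem_range_self β))

theorem IsEmbeddedSurface.tangentPlane_eq (hf : IsEmbeddedSurface f) {c x : M}
    (hc : x ∈ (chartAt E2 c).source) :
    tangentPlane f x = Submodule.span ℝ (range (basisVec f c x)) :=
  le_antisymm (hf.span_basisVec_le (mem_chart_source E2 x) hc)
    (hf.span_basisVec_le hc (mem_chart_source E2 x))

/-- `transfer` preserves covariant components in every chart, although it is defined in one. -/
theorem inner_transfer (hf : IsEmbeddedSurface f) (hg : IsEmbeddedSurface g) {c x : M}
    (hc : x ∈ (chartAt E2 c).source) (w : E3) (α : Fin 2) :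
    inner ℝ (transfer f g x w) (basisVec g c x α) = inner ℝ w (basisVec f c x α) := by
  rw [hf.basisVec_eq_sum hc (mem_chart_source E2 x), hg.basisVec_eq_sum hc (mem_chart_source E2 x)]
  simp only [inner_sum, real_inner_smul_right]
  simp only [transfer, inner_frameTransfer (hg.immersion x)]

theorem IsEmbeddedSurface.eq_of_inner_eq (hg : IsEmbeddedSurface g) {c x : M}
    (hc : x ∈ (chartAt E2 c).source) {w w' : E3} (hw : w ∈ tangentPlane g x)
    (hw' : w' ∈ tangentPlane g x)
    (h : ∀ α, inner ℝ w (basisVec g c x α) = inner ℝ w' (basisVec g c x α)) : w = w' := by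
  rw [hg.tangentPlane_eq hc] at hw hw'
  exact ADC.eq_of_inner_eq hw hw' h

theorem transfer_eq_frameTransfer (hf : IsEmbeddedSurface f) (hg : IsEmbeddedSurface g) {c x : M}
    (hc : x ∈ (chartAt E2 c).source) :
    transfer f g x = frameTransfer (basisVec f c x) (basisVec g c x) := by
  ext1 w
  refine hg.eq_of_inner_eq hc (transfer_mem f g x w) ?_ fun α => ?_
  · rw [hg.tangentPlane_eq hc]; exact frameTransfer_mem _ _ _
  · rw [inner_transfer hf hg hc, inner_frameTransfer (hg.linearIndependent_basisVec hc)]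

/-- The ratio of the area elements may be computed in any chart: the Jacobian cancels. -/
theorem areaRatio_eq (hf : IsEmbeddedSurface f) (hg : IsEmbeddedSurface g) {c x : M}
    (hc : x ∈ (chartAt E2 c).source) :
    areaRatio f g x = √(metric g c x).det / √(metric f c x).det := by
  rw [hf.det_metric_eq hc (mem_chart_source E2 x), hg.det_metric_eq hc (mem_chart_source E2 x),
    Real.sqrt_mul (sq_nonneg _), Real.sqrt_mul (sq_nonneg _), mul_div_mul_left, areaRatio]
  rw [Real.sqrt_sq_eq_abs]
  exact abs_ne_zero.2 (det_jacobian_ne_zero hc (mem_chart_source E2 x))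

theorem areaRatio_pos (hf : IsEmbeddedSurface f) (hg : IsEmbeddedSurface g) (x : M) :
    0 < areaRatio f g x :=
  div_pos (Real.sqrt_pos.2 (hg.det_metric_pos (mem_chart_source E2 x)))
    (Real.sqrt_pos.2 (hf.det_metric_pos (mem_chart_source E2 x)))

theorem transfer_transfer {k : M → T3} (hf : IsEmbeddedSurface f) (hg : IsEmbeddedSurface g)
    (hk : IsEmbeddedSurface k) (x : M) (w : E3) :
    transfer g k x (transfer f g x w) = transfer f k x w :=
  hk.eq_of_inner_eq (mem_chart_source E2 x) (transfer_mem _ _ _ _) (transfer_mem _ _ _ _)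
    fun α => by
      rw [inner_transfer hg hk (mem_chart_source E2 x),
        inner_transfer hf hg (mem_chart_source E2 x), inner_transfer hf hk (mem_chart_source E2 x)]

theorem transfer_self_of_mem (hf : IsEmbeddedSurface f) {x : M} {w : E3}
    (hw : w ∈ tangentPlane f x) : transfer f f x w = w :=
  hf.eq_of_inner_eq (mem_chart_source E2 x) (transfer_mem _ _ _ _) hw
    fun _ => inner_transfer hf hf (mem_chart_source E2 x) _ _

theorem tangentPart_eq_transfer (hf : IsEmbeddedSurface f) (p : E3) (x : M) :
    tangentPart f p x = transfer f f x p := by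
  refine hf.eq_of_inner_eq (mem_chart_source E2 x) (Submodule.starProjection_apply_mem _ _)
    (transfer_mem _ _ _ _) fun α => ?_
  rw [inner_transfer hf hf (mem_chart_source E2 x)]
  have h := (tangentPlane f x).starProjection_inner_eq_zero p (basisVec f x x α)
    (Submodule.subset_span (mem_range_self α))
  rw [inner_sub_left] at h
  rw [tangentPart]
  linarith

theorem continuous_transfer (hf : IsEmbeddedSurface f) (hg : IsEmbeddedSurface g) :
    Continuous (transfer f g) := by
  refine continuous_iff_continuousAt.2 fun x => ?_
  have hx := mem_chart_source E2 x
  refine (continuousAt_frameTransfer (hf.continuousAt_basisVec hx) (hg.continuousAt_basisVec hx)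
    (hg.immersion x)).congr ?_
  filter_upwards [(chartAt E2 x).open_source.mem_nhds hx] with y hy
  exact (transfer_eq_frameTransfer hf hg hy).symm

theorem IsEmbeddedSurface.continuousAt_sqrt_det_metric (hf : IsEmbeddedSurface f) {c x : M}
    (hc : x ∈ (chartAt E2 c).source) : ContinuousAt (fun x => √(metric f c x).det) x := by
  have h1 : ContinuousAt (fun x => (Matrix.gram ℝ (basisVec f c x)).det) x :=
    ContinuousAt.comp (f := fun x => Matrix.gram ℝ (basisVec f c x))
      (Continuous.matrix_det continuous_id).continuousAt
      (continuousAt_gram (hf.continuousAt_basisVec hc))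
  exact h1.sqrt

theorem continuous_areaRatio (hf : IsEmbeddedSurface f) (hg : IsEmbeddedSurface g) :
    Continuous (areaRatio f g) := by
  refine continuous_iff_continuousAt.2 fun x => ?_
  have hx := mem_chart_source E2 x
  refine ((hg.continuousAt_sqrt_det_metric hx).div (hf.continuousAt_sqrt_det_metric hx)
    (Real.sqrt_pos.2 (hf.det_metric_pos hx)).ne').congr ?_
  filter_upwards [(chartAt E2 x).open_source.mem_nhds hx] with y hy
  exact (areaRatio_eq hf hg hy).symm

end Transfer

/-! ### Comparison of area measures -/

section Area

variable {M : Type*} [TopologicalSpace M] [ChartedSpace E2 M]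

theorem patch_subset_source [CompactSpace M] (i : Fin (numPatches M)) :
    patch M i ⊆ (chartAt E2 (center M i)).source := fun _ hx => hx.1.1

theorem image_patch_subset [CompactSpace M] (i : Fin (numPatches M)) :
    chartAt E2 (center M i) '' patch M i ⊆
      Metric.closedBall (chartAt E2 (center M i) (center M i)) (discRadius (center M i)) := by
  rintro _ ⟨x, hx, rfl⟩
  exact Metric.ball_subset_closedBall hx.1.2

theorem image_patch_subset_target [CompactSpace M] (i : Fin (numPatches M)) :
    chartAt E2 (center M i) '' patch M i ⊆ (chartAt E2 (center M i)).target := by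
  rintro _ ⟨x, hx, rfl⟩
  exact (chartAt E2 (center M i)).map_source (patch_subset_source i hx)

theorem measurableSet_patch [CompactSpace M] [MeasurableSpace M] [BorelSpace M]
    (i : Fin (numPatches M)) : MeasurableSet (patch M i) := by
  have h : ∀ c : M, MeasurableSet (disc c) := fun c =>
    ((chartAt E2 c).isOpen_inter_preimage Metric.isOpen_ball).measurableSet
  exact (h _).diff (MeasurableSet.iUnion fun j => MeasurableSet.iUnion fun _ => h _)

theorem measurableSet_image_patch [CompactSpace M] [MeasurableSpace M] [BorelSpace M]
    (i : Fin (numPatches M)) : MeasurableSet (chartAt E2 (center M i) '' patch M i) := by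
  set φ := chartAt E2 (center M i)
  have h1 : Measurable (φ.target.domRestrict φ.symm) :=
    (continuousOn_iff_continuous_domRestrict.1 φ.continuousOn_symm).measurable
  have h2 := φ.open_target.measurableSet.subtype_image (h1 (measurableSet_patch i))
  convert h2 using 1
  rw [φ.image_eq_target_inter_inv_preimage (patch_subset_source i)]
  ext y
  simp only [mem_inter_iff, mem_preimage, mem_image, Subtype.exists, domRestrict_apply,
    exists_and_right, exists_eq_right]
  exact ⟨fun h => ⟨h.1, h.2⟩, fun ⟨h, h'⟩ => ⟨h, h'⟩⟩

theorem aemeasurable_chart_symm [CompactSpace M] [MeasurableSpace M] [BorelSpace M]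
    (i : Fin (numPatches M)) : AEMeasurable (chartAt E2 (center M i)).symm
      (volume.restrict (chartAt E2 (center M i) '' patch M i)) :=
  ((chartAt E2 (center M i)).continuousOn_symm.mono (image_patch_subset_target i)).aemeasurable
    (measurableSet_image_patch i)

variable [IsManifold (𝓡 2) ∞ M] {f g : M → T3}

theorem IsEmbeddedSurface.continuousOn_areaDensity (hf : IsEmbeddedSurface f) (c : M) :
    ContinuousOn (areaDensity f c) (chartAt E2 c).target := fun y hy => by
  have h1 := hf.continuousAt_sqrt_det_metric ((chartAt E2 c).map_target hy)
  exact (ContinuousAt.comp (f := (chartAt E2 c).symm) h1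
    ((chartAt E2 c).continuousAt_symm hy)).continuousWithinAt

variable [CompactSpace M] [MeasurableSpace M] [BorelSpace M]

theorem IsEmbeddedSurface.aemeasurable_areaDensity (hf : IsEmbeddedSurface f)
    (i : Fin (numPatches M)) :
    AEMeasurable (fun y => ENNReal.ofReal (areaDensity f (center M i) y))
      (volume.restrict (chartAt E2 (center M i) '' patch M i)) :=
  (((hf.continuousOn_areaDensity _).mono (image_patch_subset_target i)).aemeasurable
    (measurableSet_image_patch i)).ennreal_ofReal

/-- The area measures of two surfaces parametrised by the same `M` are mutually absolutely
continuous, with the ratio of the area elements as density. -/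
theorem area_eq_withDensity (hf : IsEmbeddedSurface f) (hg : IsEmbeddedSurface g) :
    area g = (area f).withDensity fun x => ENNReal.ofReal (areaRatio f g x) := by
  have hρ : Measurable fun x => ENNReal.ofReal (areaRatio f g x) :=
    (continuous_areaRatio hf hg).measurable.ennreal_ofReal
  have key : ∀ i : Fin (numPatches M), Measure.map (chartAt E2 (center M i)).symm
      ((volume.restrict (chartAt E2 (center M i) '' patch M i)).withDensity
        fun y => ENNReal.ofReal (areaDensity g (center M i) y)) =
      (Measure.map (chartAt E2 (center M i)).symm
      ((volume.restrict (chartAt E2 (center M i) '' patch M i)).withDensity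
        fun y => ENNReal.ofReal (areaDensity f (center M i) y))).withDensity
          fun x => ENNReal.ofReal (areaRatio f g x) := by
    intro i
    have hφ := aemeasurable_chart_symm i
    refine Measure.ext_of_lintegral _ fun F hF => ?_
    rw [lintegral_withDensity_eq_lintegral_mul _ hρ hF,
      lintegral_map' hF.aemeasurable (hφ.mono_ac (withDensity_absolutelyContinuous _ _)),
      lintegral_map' (hρ.mul hF).aemeasurable
        (hφ.mono_ac (withDensity_absolutelyContinuous _ _))]
    refine (lintegral_withDensity_eq_lintegral_mul₀ (hg.aemeasurable_areaDensity i)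
      (hF.comp_aemeasurable hφ)).trans (Eq.trans ?_
        (lintegral_withDensity_eq_lintegral_mul₀ (hf.aemeasurable_areaDensity i)
          ((hρ.mul hF).comp_aemeasurable hφ)).symm)
    refine setLIntegral_congr_fun (measurableSet_image_patch i) fun y hy => ?_
    have hs := (chartAt E2 (center M i)).map_target (image_patch_subset_target i hy)
    simp only [Pi.mul_apply, Function.comp_apply]
    rw [← mul_assoc]
    congr 1
    rw [areaDensity, areaDensity, ← ENNReal.ofReal_mul (Real.sqrt_nonneg _), areaRatio_eq hf hg hs,
      mul_div_cancel₀ _ (Real.sqrt_pos.2 (hf.det_metric_pos hs)).ne']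
  unfold area
  rw [← Measure.sum_fintype, ← Measure.sum_fintype, withDensity_sum]
  exact congrArg _ (funext key)

theorem IsEmbeddedSurface.isFiniteMeasure_area (hf : IsEmbeddedSurface f) :
    IsFiniteMeasure (area f) := by
  refine ⟨?_⟩
  rw [area, Measure.finsetSum_apply]
  refine ENNReal.sum_lt_top.2 fun i _ => ?_
  have hφ := aemeasurable_chart_symm (M := M) i
  rw [Measure.map_apply_of_aemeasurable (hφ.mono_ac (withDensity_absolutelyContinuous _ _))
    MeasurableSet.univ, preimage_univ, withDensity_apply _ MeasurableSet.univ,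
    Measure.restrict_univ]
  have hK := isCompact_closedBall (chartAt E2 (center M i) (center M i)) (discRadius (center M i))
  obtain ⟨C, hC⟩ := hK.exists_bound_of_continuousOn
    ((hf.continuousOn_areaDensity (center M i)).mono (exists_discRadius _).choose_spec.2)
  calc ∫⁻ y in chartAt E2 (center M i) '' patch M i,
        ENNReal.ofReal (areaDensity f (center M i) y)
      ≤ ∫⁻ _ in chartAt E2 (center M i) '' patch M i, ENNReal.ofReal C :=
        setLIntegral_mono' (measurableSet_image_patch i) fun y hy =>
          ENNReal.ofReal_le_ofReal ((le_abs_self _).trans (hC y (image_patch_subset i hy)))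
    _ = ENNReal.ofReal C * volume (chartAt E2 (center M i) '' patch M i) := setLIntegral_const _ _
    _ < ⊤ := ENNReal.mul_lt_top ENNReal.ofReal_lt_top
        ((measure_mono (image_patch_subset i)).trans_lt hK.measure_lt_top)

end Area

/-! ### The space `H¹` on different surfaces -/

section Sobolev

variable {M : Type*} [TopologicalSpace M] [ChartedSpace E2 M] [IsManifold (𝓡 2) ∞ M]
  {f g : M → T3}

theorem IsWeakGradient.transfer (hf : IsEmbeddedSurface f) (hg : IsEmbeddedSurface g)
    {u : M → ℝ} {G : M → E3} (h : IsWeakGradient f u G) :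
    IsWeakGradient g u (fun x => transfer f g x (G x)) where
  tangential x := transfer_mem f g x (G x)
  locInt := h.locInt
  locIntGrad c α := by
    refine (locallyIntegrableOn_congr ?_).2 (h.locIntGrad c α)
    refine (ae_restrict_iff' (chartAt E2 c).open_target.measurableSet).2 (.of_forall fun y hy => ?_)
    exact inner_transfer hf hg ((chartAt E2 c).map_target hy) _ _
  byParts c α ψ h1 h2 h3 := by
    rw [h.byParts c α ψ h1 h2 h3]
    congr 1
    refine setIntegral_congr_fun (chartAt E2 c).open_target.measurableSet fun y hy => ?_
    simp only [inner_transfer hf hg ((chartAt E2 c).map_target hy)]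

theorem memLp_two_of_continuous {X : Type*} [TopologicalSpace X] [CompactSpace X]
    [MeasurableSpace X] [BorelSpace X] {E : Type*} [NormedAddCommGroup E]
    [SecondCountableTopology E]
    {μ : Measure X} [IsFiniteMeasure μ] {D : X → E}
    (hD : Continuous D) : MemLp D 2 μ := by
  obtain ⟨C, hC⟩ := isCompact_univ.exists_bound_of_continuousOn hD.continuousOn
  exact MemLp.of_bound hD.aestronglyMeasurable C (.of_forall fun x => hC x (mem_univ x))

theorem memLp_two_clm_apply {X : Type*} [TopologicalSpace X] [CompactSpace X] [MeasurableSpace X]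
    [BorelSpace X] {μ : Measure X} {A : X → E3 →L[ℝ] E3} (hA : Continuous A) {G : X → E3}
    (hG : MemLp G 2 μ) : MemLp (fun x => A x (G x)) 2 μ := by
  obtain ⟨C, hC⟩ := isCompact_univ.exists_bound_of_continuousOn hA.continuousOn
  refine hG.of_le_mul (c := C) ?_ (.of_forall fun x => ?_)
  · exact (ContinuousLinearMap.apply ℝ E3).flip.aestronglyMeasurable_comp₂
      hA.aestronglyMeasurable hG.aestronglyMeasurable
  · exact ((A x).le_opNorm _).trans
      (mul_le_mul_of_nonneg_right (hC x (mem_univ x)) (norm_nonneg _))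

theorem integrable_mul_of_compact_support {s : Set E2} {h k : E2 → ℝ}
    (hh : ContinuousOn h s) (hk : Continuous k) {K : Set E2} (hK : IsCompact K) (hKs : K ⊆ s)
    (hkK : Function.support k ⊆ K) : Integrable (fun y => h y * k y) := by
  rw [← integrableOn_iff_integrable_of_support_subset
    ((Function.support_mul_subset_right h k).trans hkK)]
  exact ((hh.mono hKs).mul hk.continuousOn).integrableOn_compact hK

/-- A continuously differentiable function is weakly differentiable, with its classical surface
gradient. -/
theorem isWeakGradient_of_hasFDerivAt (hf : IsEmbeddedSurface f) {ψ : M → ℝ} {D : M → E3}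
    (hD : Continuous D) (htan : ∀ x, D x ∈ tangentPlane f x)
    (hψ : ∀ c : M, ∀ x ∈ (chartAt E2 c).source, ∃ L : E2 →L[ℝ] ℝ,
      HasFDerivAt (fun y => ψ ((chartAt E2 c).symm y)) L (chartAt E2 c x) ∧
        ∀ α, L (e α) = inner ℝ (D x) (basisVec f c x α)) :
    IsWeakGradient f ψ D := by
  have h1 : ∀ c : M, ∀ y ∈ (chartAt E2 c).target,
      DifferentiableAt ℝ (fun y => ψ ((chartAt E2 c).symm y)) y ∧
      ∀ α, fderiv ℝ (fun y => ψ ((chartAt E2 c).symm y)) y (e α) =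
        inner ℝ (D ((chartAt E2 c).symm y)) (basisVec f c ((chartAt E2 c).symm y) α) := by
    intro c y hy
    obtain ⟨L, hL, hL'⟩ := hψ c _ ((chartAt E2 c).map_target hy)
    rw [(chartAt E2 c).right_inv hy] at hL
    exact ⟨hL.differentiableAt, fun α => by rw [hL.fderiv, hL']⟩
  have h2 : ∀ c : M, ContinuousOn (fun y => ψ ((chartAt E2 c).symm y)) (chartAt E2 c).target :=
    fun c y hy => (h1 c y hy).1.continuousAt.continuousWithinAt
  have h3 : ∀ (c : M) (α : Fin 2), ContinuousOn (fun y =>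
      (inner ℝ (D ((chartAt E2 c).symm y)) (basisVec f c ((chartAt E2 c).symm y) α) : ℝ))
      (chartAt E2 c).target := by
    intro c α y hy
    have h4 := (chartAt E2 c).continuousAt_symm hy
    exact ((ContinuousAt.comp (f := (chartAt E2 c).symm) hD.continuousAt h4).inner
      (ContinuousAt.comp (f := (chartAt E2 c).symm)
        (hf.continuousAt_basisVec ((chartAt E2 c).map_target hy) α) h4)).continuousWithinAt
  refine ⟨htan, fun c => (h2 c).locallyIntegrableOn (chartAt E2 c).open_target.measurableSet,
    fun c α => (h3 c α).locallyIntegrableOn (chartAt E2 c).open_target.measurableSet, ?_⟩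
  intro c α φ hφ hφc hφs
  have h5 : ∀ y, y ∉ tsupport φ → φ y = 0 := fun y hy => image_eq_zero_of_notMem_tsupport hy
  have h6 : ∀ y, y ∉ tsupport φ → fderiv ℝ φ y = 0 := fun y hy =>
    Function.notMem_support.1 fun h => hy (support_fderiv_subset ℝ h)
  have h7 : (fun y => fderiv ℝ (fun y => ψ ((chartAt E2 c).symm y)) y (e α) * φ y) =
      fun y => inner ℝ (D ((chartAt E2 c).symm y)) (basisVec f c ((chartAt E2 c).symm y) α)
        * φ y := by
    funext y
    by_cases hy : y ∈ tsupport φ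
    · rw [(h1 c y (hφs hy)).2 α]
    · rw [h5 y hy, mul_zero, mul_zero]
  rw [setIntegral_eq_integral_of_forall_compl_eq_zero fun y hy => by
      rw [h6 y fun h => hy (hφs h)]; simp,
    setIntegral_eq_integral_of_forall_compl_eq_zero fun y hy => by
      rw [h5 y fun h => hy (hφs h), mul_zero], ← h7]
  refine integral_mul_fderiv_eq_neg_fderiv_mul_of_integrable ?_ ?_ ?_
    (fun y hy => (h1 c y (hφs hy)).1) (fun y _ => (hφ.differentiable (by simp)) y)
  · rw [h7]
    exact integrable_mul_of_compact_support (h3 c α) hφ.continuous hφc hφs subset_closure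
  · refine integrable_mul_of_compact_support (h2 c)
      ((hφ.continuous_fderiv (by simp)).clm_apply continuous_const) hφc hφs fun y hy => ?_
    by_contra h
    exact hy (by simp [h6 y h])
  · exact integrable_mul_of_compact_support (h2 c) hφ.continuous hφc hφs subset_closure

theorem IsEmbeddedSurface.eventually_norm_localRep_lt (hf : IsEmbeddedSurface f) {c x : M}
    (hc : x ∈ (chartAt E2 c).source) {δ : ℝ} (hδ : 0 < δ) :
    ∀ᶠ y in 𝓝 (chartAt E2 c x), ‖localRep f c x y‖ < δ := by
  have h := (hf.differentiableAt_localRep hc).continuousAt.norm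
  refine h.eventually (gt_mem_nhds ?_)
  simpa [localRep, (chartAt E2 c).left_inv hc, lift_self] using hδ

variable [CompactSpace M] [MeasurableSpace M] [BorelSpace M]

theorem memLp_area (hf : IsEmbeddedSurface f) (hg : IsEmbeddedSurface g)
    {E : Type*} [NormedAddCommGroup E] {G : M → E} (hG : MemLp G 2 (area f)) :
    MemLp G 2 (area g) := by
  obtain ⟨C, hC⟩ := isCompact_univ.exists_bound_of_continuousOn
    (continuous_areaRatio hf hg).continuousOn
  refine hG.of_measure_le_smul (c := ENNReal.ofReal C) ENNReal.ofReal_ne_top ?_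
  rw [area_eq_withDensity hf hg, ← withDensity_const]
  exact withDensity_mono (.of_forall fun x =>
    ENNReal.ofReal_le_ofReal ((le_abs_self _).trans (hC x (mem_univ x))))

theorem memLp_transfer (hf : IsEmbeddedSurface f) (hg : IsEmbeddedSurface g) {μ : Measure M}
    {G : M → E3} (hG : MemLp G 2 μ) : MemLp (fun x => transfer f g x (G x)) 2 μ :=
  memLp_two_clm_apply (continuous_transfer hf hg) hG

/-- The space `H¹` is the same for all surfaces parametrised by `M`; only the vector representing
the differential changes. -/
theorem IsH1.transfer (hf : IsEmbeddedSurface f) (hg : IsEmbeddedSurface g)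
    {u : M → ℝ} {G : M → E3} (h : IsH1 f u G) : IsH1 g u (fun x => transfer f g x (G x)) where
  weakGradient := h.weakGradient.transfer hf hg
  memLp := memLp_area hf hg h.memLp
  memLpGrad := memLp_area hf hg (memLp_transfer hf hg h.memLpGrad)

/-- A continuously differentiable function belongs to `H¹`, with its classical surface gradient. -/
theorem isH1_of_hasFDerivAt (hf : IsEmbeddedSurface f) {ψ : M → ℝ} {D : M → E3}
    (hD : Continuous D) (htan : ∀ x, D x ∈ tangentPlane f x)
    (hψ : ∀ c : M, ∀ x ∈ (chartAt E2 c).source, ∃ L : E2 →L[ℝ] ℝ,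
      HasFDerivAt (fun y => ψ ((chartAt E2 c).symm y)) L (chartAt E2 c x) ∧
        ∀ α, L (e α) = inner ℝ (D x) (basisVec f c x α)) :
    IsH1 f ψ D := by
  have := hf.isFiniteMeasure_area
  refine ⟨isWeakGradient_of_hasFDerivAt hf hD htan hψ,
    memLp_two_of_continuous (continuous_iff_continuousAt.2 fun x => ?_), memLp_two_of_continuous hD⟩
  have hx := mem_chart_source E2 x
  obtain ⟨L, hL, -⟩ := hψ x x hx
  refine (hL.continuousAt.comp ((chartAt E2 x).continuousAt hx)).congr ?_
  filter_upwards [(chartAt E2 x).open_source.mem_nhds hx] with y hy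
  simp [(chartAt E2 x).left_inv hy]

/-- The displacement between two nearby surfaces, in the direction `p`, is a function on `M` whose
differential is the difference of the `1`-forms that `p` induces on the two surfaces. -/
theorem isH1_displacement (hf : IsEmbeddedSurface f) (hg : IsEmbeddedSurface g)
    (p : E3) (hfg : ∀ x, ‖lift (f x) (g x)‖ < 1 / 4) :
    IsH1 f (fun x => inner ℝ p (lift (f x) (g x)))
      (fun x => transfer g f x p - transfer f f x p) := by
  refine isH1_of_hasFDerivAt hf
    (((continuous_transfer hg hf).clm_apply continuous_const).sub
      ((continuous_transfer hf hf).clm_apply continuous_const))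
    (fun x => Submodule.sub_mem _ (transfer_mem _ _ _ _) (transfer_mem _ _ _ _)) fun c x hx => ?_
  have h1 : (fun y =>
      (inner ℝ p (lift (f ((chartAt E2 c).symm y)) (g ((chartAt E2 c).symm y))) : ℝ)) =ᶠ[𝓝 (chartAt E2 c x)]
      fun y => innerSL ℝ p (lift (f x) (g x) +
        (localRep g c x y - localRep f c x y)) := by
    filter_upwards [hf.eventually_norm_localRep_lt hx (δ := 1 / 4) (by norm_num),
      hg.eventually_norm_localRep_lt hx (δ := 1 / 4) (by norm_num)] with y hy hy'
    have h0 := hfg x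
    simp only [localRep] at hy hy' ⊢
    have h2 := lift_comm (hy.trans (by norm_num))
    have h3 := lift_add (q := f x) (z := g x) (w := g ((chartAt E2 c).symm y)) (by linarith)
    have h4 := norm_add_le (lift (f x) (g x)) (lift (g x) (g ((chartAt E2 c).symm y)))
    rw [lift_add (z := f x) (by rw [h2, h3, norm_neg]; linarith), h2, h3, innerSL_apply_apply]
    congr 1
    abel
  refine ⟨_, ((innerSL ℝ p).hasFDerivAt.comp (chartAt E2 c x)
    (((hg.differentiableAt_localRep hx).hasFDerivAt.sub
      (hf.differentiableAt_localRep hx).hasFDerivAt).const_add _)).congr_of_eventuallyEq h1,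
    fun α => ?_⟩
  rw [inner_sub_left, inner_transfer hg hf hx, inner_transfer hf hf hx, ← inner_sub_right]
  rfl

end Sobolev

/-! ### The Dirichlet energy as a form on a fixed surface -/

section EnergyForm

/-- The symmetric endomorphism representing the quadratic form
`ξ ↦ √(b / a) b^{αβ} (ξ · a_α) (ξ · a_β)` for two frames `a`, `b` of planes, where under the root
`a` and `b` stand for the determinants of the first fundamental forms. -/
def frameForm (a b : Fin 2 → E3) : E3 →L[ℝ] E3 :=
  (√(Matrix.gram ℝ b).det / √(Matrix.gram ℝ a).det) •
    ∑ α, ∑ β, (Matrix.gram ℝ b)⁻¹ α β • (innerSL ℝ (a α)).smulRight (a β)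

theorem inner_frameForm (a b : Fin 2 → E3) (ξ η : E3) :
    inner ℝ (frameForm a b ξ) η = √(Matrix.gram ℝ b).det / √(Matrix.gram ℝ a).det *
      ∑ α, ∑ β, (Matrix.gram ℝ b)⁻¹ α β * inner ℝ ξ (a α) * inner ℝ η (a β) := by
  simp only [frameForm, Fin.sum_univ_two, smul_apply,
    add_apply, ContinuousLinearMap.smulRight_apply, innerSL_apply_apply,
    inner_add_left, real_inner_smul_left, real_inner_comm _ ξ, real_inner_comm _ η]
  ring

theorem contDiffAt_gram {X : Type*} [NormedAddCommGroup X] [NormedSpace ℝ X] {n : WithTop ℕ∞}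
    {b : X → Fin 2 → E3} {z : X} (hb : ∀ α, ContDiffAt ℝ n (fun z => b z α) z) (α β : Fin 2) :
    ContDiffAt ℝ n (fun z => Matrix.gram ℝ (b z) α β) z :=
  (hb α).inner ℝ (hb β)

theorem contDiffAt_det_gram {X : Type*} [NormedAddCommGroup X] [NormedSpace ℝ X]
    {n : WithTop ℕ∞} {b : X → Fin 2 → E3} {z : X}
    (hb : ∀ α, ContDiffAt ℝ n (fun z => b z α) z) :
    ContDiffAt ℝ n (fun z => (Matrix.gram ℝ (b z)).det) z := by
  simp only [Matrix.det_fin_two]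
  exact ((contDiffAt_gram hb 0 0).mul (contDiffAt_gram hb 1 1)).sub
    ((contDiffAt_gram hb 0 1).mul (contDiffAt_gram hb 1 0))

theorem gram_inv_eq (b : Fin 2 → E3) : (Matrix.gram ℝ b)⁻¹ = (Matrix.gram ℝ b).det⁻¹ •
    !![Matrix.gram ℝ b 1 1, -Matrix.gram ℝ b 0 1; -Matrix.gram ℝ b 1 0, Matrix.gram ℝ b 0 0] := by
  rw [Matrix.inv_def, Ring.inverse_eq_inv', Matrix.adjugate_fin_two]

theorem contDiffAt_frameForm {X : Type*} [NormedAddCommGroup X] [NormedSpace ℝ X]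
    {n : WithTop ℕ∞} {a b : X → Fin 2 → E3} {z : X}
    (ha : ∀ α, ContDiffAt ℝ n (fun z => a z α) z) (hb : ∀ α, ContDiffAt ℝ n (fun z => b z α) z)
    (hai : LinearIndependent ℝ (a z)) (hbi : LinearIndependent ℝ (b z)) :
    ContDiffAt ℝ n (fun z => frameForm (a z) (b z)) z := by
  have hda := (Matrix.posDef_gram_of_linearIndependent hai).det_pos
  have hdb := (Matrix.posDef_gram_of_linearIndependent hbi).det_pos
  have h1 : ∀ α β, ContDiffAt ℝ n (fun z => (Matrix.gram ℝ (b z))⁻¹ α β) z := by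
    intro α β
    have h2 := (contDiffAt_det_gram hb).inv hdb.ne'
    simp only [gram_inv_eq, Matrix.smul_apply, smul_eq_mul]
    refine h2.mul ?_
    fin_cases α <;> fin_cases β
    · exact contDiffAt_gram hb 1 1
    · exact (contDiffAt_gram hb 0 1).neg
    · exact (contDiffAt_gram hb 1 0).neg
    · exact contDiffAt_gram hb 0 0
  have h3 : ∀ α, ContDiffAt ℝ n (fun z => innerSL ℝ (a z α)) z := fun α =>
    (innerSL ℝ (E := E3)).contDiff.contDiffAt.comp z (ha α)
  have h4 : ∀ α β, ContDiffAt ℝ n (fun z => (innerSL ℝ (a z α)).smulRight (a z β)) z :=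
    fun α β => (h3 α).smulRight (ha β)
  unfold frameForm
  exact (((contDiffAt_det_gram hb).sqrt hdb.ne').div ((contDiffAt_det_gram ha).sqrt hda.ne')
    (Real.sqrt_pos.2 hda).ne').smul
    (ContDiffAt.sum fun α _ => ContDiffAt.sum fun β _ => (h1 α β).smul (h4 α β))

variable {M : Type*} [TopologicalSpace M] [ChartedSpace E2 M]

/-- The Dirichlet energy density of `g`, as an endomorphism field over `f`: a `1`-form represented
by the field `ξ` tangent to `f` has energy `∫ ξ · energyForm f g ξ` with respect to the metric of
`g`, the integral being over the area of `f`. -/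
def energyForm (f g : M → T3) (x : M) : E3 →L[ℝ] E3 :=
  frameForm (basisVec f x x) (basisVec g x x)

variable {f g : M → T3}

/-- The energy form is the metric of `g`, weighted by the area, pulled back to `f`. -/
theorem inner_energyForm (hg : IsEmbeddedSurface g) (x : M) (ξ η : E3) :
    inner ℝ (energyForm f g x ξ) η =
      areaRatio f g x * inner ℝ (transfer f g x ξ) (transfer f g x η) := by
  rw [energyForm, inner_frameForm, transfer, inner_frameTransfer_frameTransfer (hg.immersion x)]
  rfl

/-- All points of the compact surface stay close to their position at time `t₀`. -/
theorem IsSmoothFamily.eventually_norm_lift_lt [CompactSpace M] {J : Set ℝ} {r : ℝ → M → T3}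
    (hr : IsSmoothFamily J r) {t₀ : ℝ} (ht₀ : t₀ ∈ J) :
    ∀ᶠ t in 𝓝 t₀, ∀ x, ‖lift (r t₀ x) (r t x)‖ < 1 / 4 := by
  have h := isCompact_univ.eventually_forall_of_forall_eventually (x₀ := t₀)
    (P := fun t x => ‖lift (r t₀ x) (r t x)‖ < 1 / 4) fun x₀ _ => by
      have h1 : ∀ᶠ z : ℝ × M in 𝓝 (t₀, x₀), ‖lift (r t₀ x₀) (r z.1 z.2)‖ < 1 / 8 := by
        have := (hr.tendsto_lift ht₀ x₀).norm
        rw [norm_zero] at this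
        exact this.eventually (gt_mem_nhds (by norm_num))
      have h2 : Tendsto (fun z : ℝ × M => (t₀, z.2)) (𝓝 (t₀, x₀)) (𝓝 (t₀, x₀)) :=
        (continuous_const.prodMk continuous_snd).continuousAt
      filter_upwards [h1, h2.eventually h1] with z hz hz'
      rw [lift_sub (q := r t₀ x₀) (by linarith)]
      exact (norm_sub_le _ _).trans_lt (by linarith)
  filter_upwards [h] with t ht x using ht x (mem_univ x)

variable [IsManifold (𝓡 2) ∞ M]

theorem energyForm_eq_frameForm (hf : IsEmbeddedSurface f) (hg : IsEmbeddedSurface g) {c x : M}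
    (hc : x ∈ (chartAt E2 c).source) :
    energyForm f g x = frameForm (basisVec f c x) (basisVec g c x) := by
  ext1 ξ
  refine ext_inner_right ℝ fun η => ?_
  rw [inner_energyForm hg, transfer_eq_frameTransfer hf hg hc,
    inner_frameTransfer_frameTransfer (hg.linearIndependent_basisVec hc), inner_frameForm,
    areaRatio_eq hf hg hc]
  rfl

theorem inner_energyForm_self (hf : IsEmbeddedSurface f) {x : M} {ξ η : E3}
    (hξ : ξ ∈ tangentPlane f x) (hη : η ∈ tangentPlane f x) :
    inner ℝ (energyForm f f x ξ) η = inner ℝ ξ η := by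
  rw [inner_energyForm hf, transfer_self_of_mem hf hξ, transfer_self_of_mem hf hη, areaRatio,
    div_self (Real.sqrt_pos.2 (hf.det_metric_pos (mem_chart_source E2 x))).ne', one_mul]

theorem continuous_energyForm (hf : IsEmbeddedSurface f) (hg : IsEmbeddedSurface g) :
    Continuous (energyForm f g) := by
  have h : ∀ x, energyForm f g x = areaRatio f g x •
      ((ContinuousLinearMap.adjoint (transfer f g x)).comp (transfer f g x)) := fun x => by
    ext1 ξ
    refine ext_inner_right ℝ fun η => ?_
    rw [inner_energyForm hg, smul_apply, real_inner_smul_left,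
      ContinuousLinearMap.comp_apply, ContinuousLinearMap.adjoint_inner_left]
  have ht := continuous_transfer hf hg
  rw [funext h]
  exact (continuous_areaRatio hf hg).smul
    (((ContinuousLinearMap.adjoint (𝕜 := ℝ) (E := E3) (F := E3)).continuous.comp ht).clm_comp ht)

/-- Near `t₀` the energy form is Lipschitz in time, uniformly on the compact surface. -/
theorem IsSmoothFamily.exists_lipschitz_energyForm [CompactSpace M] {J : Set ℝ} {r : ℝ → M → T3}
    (hr : IsSmoothFamily J r) (hemb : ∀ t ∈ J, IsEmbeddedSurface (r t)) {t₀ : ℝ}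
    (hJ : J ∈ 𝓝 t₀) : ∃ C : NNReal, ∃ s ∈ 𝓝 t₀, s ⊆ J ∧
      ∀ x, LipschitzOnWith C (fun t => energyForm (r t₀) (r t) x) s := by
  have ht₀ := mem_of_mem_nhds hJ
  have hloc : ∀ x₀ : M, ∃ C : NNReal, ∃ s ∈ 𝓝 t₀, ∃ U ∈ 𝓝 x₀,
      ∀ x ∈ U, LipschitzOnWith C (fun t => energyForm (r t₀) (r t) x) s := by
    intro x₀
    have hx₀ := mem_chart_source E2 x₀
    set R := jointRep r t₀ x₀ x₀
    have hR := hr.contDiffAt_jointRep ht₀ hx₀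
    have hb : ∀ α, ContDiffAt ℝ 1 (partialDeriv R α) (t₀, chartAt E2 x₀ x₀) := fun α =>
      (contDiffAt_partialDeriv hR α).of_le (by simp)
    have ha : ∀ α, ContDiffAt ℝ 1 (fun z : ℝ × E2 => partialDeriv R α (t₀, z.2))
        (t₀, chartAt E2 x₀ x₀) := fun α =>
      ContDiffAt.comp (f := fun z : ℝ × E2 => (t₀, z.2)) (t₀, chartAt E2 x₀ x₀) (hb α)
        (contDiffAt_const.prodMk contDiffAt_snd)
    have hbas := hr.eventually_basisVec ht₀ hx₀
    have hi : LinearIndependent ℝ fun α => partialDeriv R α (t₀, chartAt E2 x₀ x₀) := by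
      have h1 : (fun α => partialDeriv R α (t₀, chartAt E2 x₀ x₀)) = basisVec (r t₀) x₀ x₀ :=
        funext fun α => (hbas.self_of_nhds α).symm
      rw [h1]
      exact (hemb t₀ ht₀).immersion x₀
    obtain ⟨C, S, hS, hC⟩ := (contDiffAt_frameForm
      (a := fun (z : ℝ × E2) α => partialDeriv R α (t₀, z.2))
      (b := fun (z : ℝ × E2) α => partialDeriv R α z) ha hb hi hi).exists_lipschitzOnWith
    have hc : ContinuousAt (fun z : ℝ × M => (z.1, chartAt E2 x₀ z.2)) (t₀, x₀) :=
      continuousAt_fst.prodMk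
        (ContinuousAt.comp (x := (t₀, x₀)) ((chartAt E2 x₀).continuousAt hx₀) continuousAt_snd)
    have hev : ∀ᶠ z : ℝ × M in 𝓝 (t₀, x₀), (z.1 ∈ J ∧ z.2 ∈ (chartAt E2 x₀).source) ∧
        (z.1, chartAt E2 x₀ z.2) ∈ S ∧ ∀ α, basisVec (r z.1) x₀ z.2 α =
          partialDeriv R α (z.1, chartAt E2 x₀ z.2) :=
      ((continuousAt_fst.eventually_mem hJ).and
        (continuousAt_snd.eventually_mem ((chartAt E2 x₀).open_source.mem_nhds hx₀))).and
        ((hc.eventually hS).and hbas)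
    rw [nhds_prod_eq] at hev
    obtain ⟨s, hs, U, hU, hsU⟩ := mem_prod_iff.1 hev
    refine ⟨C, s, hs, U, hU, fun x hx => ?_⟩
    have heq : ∀ t ∈ s, energyForm (r t₀) (r t) x = frameForm
        (fun α => partialDeriv R α (t₀, chartAt E2 x₀ x))
        (fun α => partialDeriv R α (t, chartAt E2 x₀ x)) := fun t ht => by
      obtain ⟨⟨h1, h2⟩, h3, h4⟩ := hsU (mk_mem_prod ht hx)
      obtain ⟨-, -, h5⟩ := hsU (mk_mem_prod (mem_of_mem_nhds hs) hx)
      rw [energyForm_eq_frameForm (hemb t₀ ht₀) (hemb t h1) h2, ← funext h4, ← funext h5]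
    refine LipschitzOnWith.of_dist_le_mul fun t ht t' ht' => ?_
    rw [heq t ht, heq t' ht']
    have h6 := hC.dist_le_mul _ (hsU (mk_mem_prod ht hx)).2.1 _ (hsU (mk_mem_prod ht' hx)).2.1
    simpa [Prod.dist_eq] using h6
  -- finitely many of the neighbourhoods cover the surface
  choose C s hs U hU hC using hloc
  obtain ⟨F, hF⟩ := isCompact_univ.elim_nhds_subcover U fun x _ => hU x
  refine ⟨F.sup C, (⋂ x ∈ F, s x) ∩ J, inter_mem ((Filter.biInter_finset_mem F).2
    fun x _ => hs x) hJ, inter_subset_right, fun x => ?_⟩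
  obtain ⟨y, hy, hxy⟩ := mem_iUnion₂.1 (hF.2 (mem_univ x))
  exact ((hC y x hxy).mono (inter_subset_left.trans (biInter_subset_of_mem hy))).weaken
    (Finset.le_sup hy)

end EnergyForm

/-! ### The first variation of the metric -/

section Shape

variable {M : Type*} [TopologicalSpace M] [ChartedSpace E2 M] [IsManifold (𝓡 2) ∞ M]

/-- The time derivative of the lifted family does not depend on the base point of the lift. -/
theorem IsSmoothFamily.eventually_timeDeriv {J : Set ℝ} {r : ℝ → M → T3}
    (hr : IsSmoothFamily J r) {t₀ : ℝ} (ht₀ : t₀ ∈ J) {V : M → E3}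
    (hV : ∀ x, HasDerivAt (fun t => lift (r t₀ x) (r t x)) (V x) t₀) (x : M) :
    ∀ᶠ y in 𝓝 (chartAt E2 x x),
      fderiv ℝ (jointRep r t₀ x x) (t₀, y) (1, 0) = V ((chartAt E2 x).symm y) := by
  have hx := mem_chart_source E2 x
  have hR := hr.contDiffAt_jointRep ht₀ hx
  have h0 : Tendsto (fun y : E2 => (t₀, y)) (𝓝 (chartAt E2 x x)) (𝓝 (t₀, chartAt E2 x x)) :=
    (continuous_const.prodMk continuous_id).continuousAt
  have h1 : ∀ᶠ z in 𝓝 (t₀, chartAt E2 x x), ‖jointRep r t₀ x x z‖ < 1 / 2 := by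
    refine hR.continuousAt.norm.eventually (gt_mem_nhds ?_)
    simp [jointRep, (chartAt E2 x).left_inv hx, lift_self]
  have hd := (hR.of_le (m := 1) (by simp)).eventually (by simp)
  filter_upwards [h0.eventually (eventually_eventually_nhds.2 h1), h0.eventually hd]
    with y hy hyd
  have h2 : HasDerivAt (fun t => jointRep r t₀ x x (t, y))
      (fderiv ℝ (jointRep r t₀ x x) (t₀, y) (1, 0)) t₀ := by
    have := (hyd.differentiableAt (by simp)).hasFDerivAt.comp_hasDerivAt t₀
      ((hasDerivAt_id t₀).prodMk (hasDerivAt_const t₀ y))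
    exact this
  have h3 : ∀ᶠ t in 𝓝 t₀, ‖jointRep r t₀ x x (t, y)‖ < 1 / 2 :=
    (continuous_id.prodMk continuous_const).continuousAt.eventually hy
  refine (h2.sub_const (jointRep r t₀ x x (t₀, y))).unique
    ((hV ((chartAt E2 x).symm y)).congr_of_eventuallyEq ?_)
  filter_upwards [h3] with t ht
  have h4 := hy.self_of_nhds
  exact (lift_sub (by simpa [jointRep] using (add_lt_add h4 ht).trans_eq (by norm_num))).symm

theorem hasFDerivAt_fderiv_slice {F : ℝ × E2 → E3} {t : ℝ} {y : E2} (hF : ContDiffAt ℝ ∞ F (t, y))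
    (w : ℝ × E2) : HasFDerivAt (fun y => fderiv ℝ F (t, y) w)
      (((fderiv ℝ (fderiv ℝ F) (t, y)).flip w).comp (ContinuousLinearMap.inr ℝ ℝ E2)) y := by
  have h1 : DifferentiableAt ℝ (fderiv ℝ F) (t, y) :=
    (hF.fderiv_right (m := ∞) (by simp)).differentiableAt (by simp)
  have h2 := (h1.hasFDerivAt.comp y (hasFDerivAt_prodMk_right t y)).clm_apply
    (hasFDerivAt_const w y)
  refine h2.congr_fderiv ?_
  ext
  simp

theorem secondForm_eq {J : Set ℝ} {r : ℝ → M → T3} (hr : IsSmoothFamily J r) {t₀ : ℝ}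
    (ht₀ : t₀ ∈ J) (n : M → E3) (x : M) (α β : Fin 2) :
    secondForm (r t₀) n x x α β = inner ℝ (n x)
      (fderiv ℝ (fderiv ℝ (jointRep r t₀ x x)) (t₀, chartAt E2 x x) (0, e β) (0, e α)) := by
  have hR := hr.contDiffAt_jointRep ht₀ (mem_chart_source E2 x)
  have h0 : Tendsto (fun y : E2 => (t₀, y)) (𝓝 (chartAt E2 x x)) (𝓝 (t₀, chartAt E2 x x)) :=
    (continuous_const.prodMk continuous_id).continuousAt
  have hd := (hR.of_le (m := 1) (by simp)).eventually (by simp)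
  have h1 : (fun y => fderiv ℝ (localRep (r t₀) x x) y (e α)) =ᶠ[𝓝 (chartAt E2 x x)]
      fun y => fderiv ℝ (jointRep r t₀ x x) (t₀, y) (0, e α) := by
    filter_upwards [h0.eventually hd] with y hy
    have h2 : fderiv ℝ (localRep (r t₀) x x) y = _ :=
      (hasFDerivAt_slice (hy.differentiableAt (by simp))).fderiv
    rw [h2]
    rfl
  simp only [secondForm, Matrix.of_apply]
  rw [h1.fderiv_eq, (hasFDerivAt_fderiv_slice hR (0, e α)).fderiv]
  rfl

/-- Under a normal velocity `v n` the first fundamental form changes at the rate `-2 v b`. -/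
theorem IsSmoothFamily.hasDerivAt_metric {J : Set ℝ} {r : ℝ → M → T3} (hr : IsSmoothFamily J r)
    {t₀ : ℝ} (hJ : J ∈ 𝓝 t₀) (hemb : IsEmbeddedSurface (r t₀)) {n : M → E3}
    (hn : IsUnitNormal (r t₀) n) {v : M → ℝ}
    (hv : ∀ x, HasDerivAt (fun t => lift (r t₀ x) (r t x)) (v x • n x) t₀) (x : M) (α β : Fin 2) :
    HasDerivAt (fun t => metric (r t) x x α β)
      (-v x * (secondForm (r t₀) n x x α β + secondForm (r t₀) n x x β α)) t₀ := by
  have ht₀ := mem_of_mem_nhds hJ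
  have hx := mem_chart_source E2 x
  set R := jointRep r t₀ x x
  set y₀ := chartAt E2 x x with hy₀
  have hR : ContDiffAt ℝ ∞ R (t₀, y₀) := hr.contDiffAt_jointRep ht₀ hx
  have hsymm : IsSymmSndFDerivAt ℝ R (t₀, y₀) := 
    hR.isSymmSndFDerivAt (by
      simpa using (mod_cast le_top : ((2 : ℕ∞) : WithTop ℕ∞) ≤ ∞))
  have hbas := hr.eventually_basisVec ht₀ hx
  have hbas₀ : ∀ γ, basisVec (r t₀) x x γ = partialDeriv R γ (t₀, y₀) := hbas.self_of_nhds
  have htime := hr.eventually_timeDeriv ht₀ hv x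
  have hV₀ : fderiv ℝ R (t₀, y₀) (1, 0) = v x • n x := by
    simpa [hy₀, (chartAt E2 x).left_inv hx] using htime.self_of_nhds
  -- the velocity is orthogonal to the coordinate vectors at all points near `x`
  have horth : ∀ γ, (fun y => (inner ℝ (fderiv ℝ R (t₀, y) (1, 0)) (partialDeriv R γ (t₀, y)) : ℝ))
      =ᶠ[𝓝 y₀] fun _ => 0 := by
    intro γ
    have h1 : Tendsto (fun y : E2 => (t₀, (chartAt E2 x).symm y)) (𝓝 y₀) (𝓝 (t₀, x)) := by
      have h2 := (chartAt E2 x).continuousAt_symm ((chartAt E2 x).map_source hx)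
      have h3 : ContinuousAt (fun y : E2 => (t₀, (chartAt E2 x).symm y)) y₀ :=
        continuousAt_const.prodMk h2
      simpa [ContinuousAt, hy₀, (chartAt E2 x).left_inv hx] using h3
    filter_upwards [htime, h1.eventually hbas,
      (chartAt E2 x).open_target.mem_nhds ((chartAt E2 x).map_source hx)] with y hy hyb hyt
    have h4 := hyb γ
    simp only [(chartAt E2 x).right_inv hyt] at h4
    rw [hy, ← h4, real_inner_smul_left, (hn _).2, mul_zero]
    rw [hemb.tangentPlane_eq ((chartAt E2 x).map_target hyt)]
    exact Submodule.subset_span (mem_range_self γ)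
  -- differentiating the orthogonality along the surface gives `∂_γ (v n) · a_δ = -v b_{δγ}`, and
  -- the left-hand side is `∂_t a_γ · a_δ` because the derivatives in time and space commute
  have hkey : ∀ γ δ, inner ℝ (fderiv ℝ (fderiv ℝ R) (t₀, y₀) (1, 0) (0, e γ))
      (basisVec (r t₀) x x δ) = -v x * secondForm (r t₀) n x x δ γ := by
    intro γ δ
    have h1 := ((hasFDerivAt_fderiv_slice hR (1, 0)).inner ℝ
      (hasFDerivAt_fderiv_slice hR (0, e δ))).fderiv
    have h2 := (horth δ).fderiv_eq (𝕜 := ℝ)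
    have h3 := congrArg (fun L : E2 →L[ℝ] ℝ => L (e γ)) (h1.symm.trans h2)
    simp only [ContinuousLinearMap.comp_apply, ContinuousLinearMap.prod_apply,
      ContinuousLinearMap.inr_apply, ContinuousLinearMap.flip_apply, fderivInnerCLM_apply,
      fderiv_fun_const, Pi.zero_apply, zero_apply, hV₀,
      real_inner_smul_left] at h3
    rw [secondForm_eq hr ht₀, hbas₀, hsymm (1, 0) (0, e γ)]
    simp only [partialDeriv]
    linarith
  have hda : ∀ γ, HasDerivAt (fun t => partialDeriv R γ (t, y₀))
      (fderiv ℝ (fderiv ℝ R) (t₀, y₀) (1, 0) (0, e γ)) t₀ := by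
    intro γ
    have h1 : DifferentiableAt ℝ (fderiv ℝ R) (t₀, y₀) :=
      (hR.fderiv_right (m := ∞) (by simp)).differentiableAt (by simp)
    have h2 := h1.hasFDerivAt.comp_hasDerivAt t₀
      ((hasDerivAt_id t₀).prodMk (hasDerivAt_const t₀ y₀))
    have h3 := h2.clm_apply (hasDerivAt_const t₀ ((0 : ℝ), e γ))
    exact h3.congr_deriv (by simp)
  have h1 := (hda α).inner ℝ (hda β)
  have h2 : (fun t => metric (r t) x x α β) =ᶠ[𝓝 t₀]
      fun t => inner ℝ (partialDeriv R α (t, y₀)) (partialDeriv R β (t, y₀)) := by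
    have h3 : Tendsto (fun t : ℝ => (t, x)) (𝓝 t₀) (𝓝 (t₀, x)) :=
      (continuous_id.prodMk continuous_const).continuousAt
    filter_upwards [h3.eventually hbas] with t ht
    simp only [metric, Matrix.of_apply, ht, R, y₀]
  refine (h1.congr_of_eventuallyEq h2).congr_deriv ?_
  rw [← hbas₀, ← hbas₀, hkey, real_inner_comm, hkey]
  ring

/-- The derivative of `√(det g / D) g^{αβ} θ_α θ_β` at a time when `det g = D`, for a symmetric matrix
`g` with `ġ = -v (b + bᵀ)`: the form `2 v (b - H I)` on the vector with covariant components `θ`. -/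
theorem hasDerivAt_sqrt_det_mul_inv {g₀₀ g₀₁ g₁₁ : ℝ → ℝ} {t v b₀₀ b₀₁ b₁₀ b₁₁ : ℝ}
    (h₀₀ : HasDerivAt g₀₀ (-v * (b₀₀ + b₀₀)) t) (h₀₁ : HasDerivAt g₀₁ (-v * (b₀₁ + b₁₀)) t)
    (h₁₁ : HasDerivAt g₁₁ (-v * (b₁₁ + b₁₁)) t) {D : ℝ}
    (hD : D = g₀₀ t * g₁₁ t - g₀₁ t * g₀₁ t) (hD0 : 0 < D) (θ₀ θ₁ : ℝ) :
    HasDerivAt (fun s => √(g₀₀ s * g₁₁ s - g₀₁ s * g₀₁ s) / √D *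
        ((g₀₀ s * g₁₁ s - g₀₁ s * g₀₁ s)⁻¹ *
          (g₁₁ s * θ₀ * θ₀ - g₀₁ s * θ₀ * θ₁ - g₀₁ s * θ₁ * θ₀ + g₀₀ s * θ₁ * θ₁)))
      (2 * v * ((b₀₀ * (D⁻¹ * (g₁₁ t * θ₀ - g₀₁ t * θ₁)) ^ 2 +
          (b₀₁ + b₁₀) * (D⁻¹ * (g₁₁ t * θ₀ - g₀₁ t * θ₁)) * (D⁻¹ * (g₀₀ t * θ₁ - g₀₁ t * θ₀)) +
          b₁₁ * (D⁻¹ * (g₀₀ t * θ₁ - g₀₁ t * θ₀)) ^ 2) -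
        1 / 2 * (D⁻¹ * (g₁₁ t * b₀₀ - g₀₁ t * (b₀₁ + b₁₀) + g₀₀ t * b₁₁)) *
          (D⁻¹ * (g₁₁ t * θ₀ * θ₀ - g₀₁ t * θ₀ * θ₁ - g₀₁ t * θ₁ * θ₀ + g₀₀ t * θ₁ * θ₁)))) t := by
  have hDd := (h₀₀.mul h₁₁).sub (h₀₁.mul h₀₁)
  have hne : g₀₀ t * g₁₁ t - g₀₁ t * g₀₁ t ≠ 0 := by rw [← hD]; exact hD0.ne'
  have hN := (((h₁₁.mul_const θ₀).mul_const θ₀).sub ((h₀₁.mul_const θ₀).mul_const θ₁)).sub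
    ((h₀₁.mul_const θ₁).mul_const θ₀) |>.add ((h₀₀.mul_const θ₁).mul_const θ₁)
  refine (((hDd.sqrt hne).div_const (√D)).mul ((hDd.inv hne).mul hN)).congr_deriv ?_
  simp only [Pi.mul_apply, Pi.sub_apply, Pi.inv_apply, Pi.add_apply]
  rw [← hD]
  -- writing `D = s²` turns both sides into rational functions of `s`
  obtain ⟨s, hs, rfl⟩ : ∃ s : ℝ, 0 < s ∧ D = s ^ 2 :=
    ⟨√D, Real.sqrt_pos.2 hD0, (Real.sq_sqrt hD0.le).symm⟩
  rw [Real.sqrt_sq hs.le]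
  have hs' := hs.ne'
  generalize g₀₀ t = x at *
  generalize g₀₁ t = y at *
  generalize g₁₁ t = z at *
  field_simp
  linear_combination (2 * v * (θ₀ * (-((1 + 1) * b₁₁ * θ₀) - -((b₀₁ + b₁₀) * θ₁) -
    -((b₀₁ + b₁₀) * θ₁)) + -(b₀₀ * (1 + 1) * θ₁ ^ 2))) * hD

/-- The pointwise derivative of the energy form is the quadratic form `2 v (b - H I)`. -/
theorem IsSmoothFamily.hasDerivAt_energyForm {J : Set ℝ} {r : ℝ → M → T3}
    (hr : IsSmoothFamily J r) {t₀ : ℝ} (hJ : J ∈ 𝓝 t₀) (hemb : IsEmbeddedSurface (r t₀))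
    {n : M → E3} (hn : IsUnitNormal (r t₀) n) {v : M → ℝ}
    (hv : ∀ x, HasDerivAt (fun t => lift (r t₀ x) (r t x)) (v x • n x) t₀) (x : M) {w : E3}
    (hw : w ∈ tangentPlane (r t₀) x) :
    HasDerivAt (fun t => inner ℝ (energyForm (r t₀) (r t) x w) w)
      (2 * v x * (secondFormQuad (r t₀) n x w - meanCurv (r t₀) n x * inner ℝ w w)) t₀ := by
  have hg := hr.hasDerivAt_metric hJ hemb hn hv x
  have hD := hemb.det_metric_pos (mem_chart_source E2 x)
  have hww : inner ℝ w w = ∑ α, ∑ β, (metric (r t₀) x x)⁻¹ α β *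
      inner ℝ w (basisVec (r t₀) x x α) * inner ℝ w (basisVec (r t₀) x x β) := by
    have h := inner_frameTransfer_frameTransfer (a := basisVec (r t₀) x x) (hemb.immersion x) w w
    have h' : frameTransfer (basisVec (r t₀) x x) (basisVec (r t₀) x x) w = w :=
      transfer_self_of_mem hemb hw
    rw [h'] at h
    exact h
  have hsym : ∀ t, metric (r t) x x 1 0 = metric (r t) x x 0 1 := fun t =>
    real_inner_comm (basisVec (r t) x x 0) (basisVec (r t) x x 1)
  have hinv : ∀ t, (metric (r t) x x)⁻¹ = (metric (r t) x x).det⁻¹ •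
      !![metric (r t) x x 1 1, -metric (r t) x x 0 1;
        -metric (r t) x x 0 1, metric (r t) x x 0 0] :=
    fun t => by
      have := gram_inv_eq (basisVec (r t) x x)
      rw [← metric_eq_gram, hsym] at this
      exact this
  have hdet : ∀ t, (metric (r t) x x).det = metric (r t) x x 0 0 * metric (r t) x x 1 1 -
      metric (r t) x x 0 1 * metric (r t) x x 0 1 := fun t => by rw [Matrix.det_fin_two, hsym]
  have key := hasDerivAt_sqrt_det_mul_inv (hg 0 0) (hg 0 1) (hg 1 1) (hdet t₀) hD
    (inner ℝ w (basisVec (r t₀) x x 0)) (inner ℝ w (basisVec (r t₀) x x 1))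
  simp only [energyForm, inner_frameForm, ← metric_eq_gram]
  rw [hww]
  refine (key.congr_deriv ?_).congr_of_eventuallyEq (.of_forall fun t => ?_)
  · simp only [secondFormQuad, meanCurv, contra, Fin.sum_univ_two, hinv, Matrix.smul_apply,
      smul_eq_mul, Matrix.of_apply, Matrix.cons_val_zero, Matrix.cons_val_one, Matrix.cons_val',
      Matrix.cons_val_fin_one]
    ring
  · simp only [Fin.sum_univ_two, hinv, Matrix.smul_apply,
      smul_eq_mul, Matrix.of_apply, Matrix.cons_val_zero, Matrix.cons_val_one, Matrix.cons_val',
      Matrix.cons_val_fin_one]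
    rw [hdet t]
    ring

end Shape

/-! ### Perturbation of quadratic energies -/

section Perturbation

theorem integrable_inner_of_memLp {X : Type*} [MeasurableSpace X] {μ : Measure X} {ξ η : X → E3}
    (hξ : MemLp ξ 2 μ) (hη : MemLp η 2 μ) : Integrable (fun x => (inner ℝ (ξ x) (η x) : ℝ)) μ :=
  (hξ.norm.integrable_mul hη.norm).mono' (hξ.aestronglyMeasurable.inner hη.aestronglyMeasurable)
    (.of_forall fun x => norm_inner_le_norm (ξ x) (η x))

variable {X : Type*} [TopologicalSpace X] [CompactSpace X] [MeasurableSpace X] [BorelSpace X]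
  {μ : Measure X}

theorem integrable_inner_clm_apply {A : X → E3 →L[ℝ] E3} (hA : Continuous A) {ξ η : X → E3}
    (hξ : MemLp ξ 2 μ) (hη : MemLp η 2 μ) :
    Integrable (fun x => (inner ℝ (A x (ξ x)) (η x) : ℝ)) μ :=
  integrable_inner_of_memLp (memLp_two_clm_apply hA hξ) hη

theorem abs_integral_inner_sub_le {A B : X → E3 →L[ℝ] E3} (hA : Continuous A) (hB : Continuous B)
    {ε : ℝ} (hAB : ∀ x, ‖A x - B x‖ ≤ ε) {ξ η : X → E3} (hξ : MemLp ξ 2 μ) (hη : MemLp η 2 μ) :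
    |∫ x, inner ℝ (B x (ξ x)) (η x) ∂μ - ∫ x, inner ℝ (A x (ξ x)) (η x) ∂μ| ≤
      ∫ x, ε * (‖ξ x‖ * ‖η x‖) ∂μ := by
  rw [← integral_sub (integrable_inner_clm_apply hB hξ hη) (integrable_inner_clm_apply hA hξ hη)]
  refine (norm_integral_le_integral_norm _).trans (integral_mono_of_nonneg
    (.of_forall fun _ => norm_nonneg (_ : ℝ)) ((hξ.norm.integrable_mul hη.norm).const_mul ε)
    (.of_forall fun x => ?_))
  have h : inner ℝ (B x (ξ x)) (η x) - inner ℝ (A x (ξ x)) (η x) =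
      (inner ℝ ((B x - A x) (ξ x)) (η x) : ℝ) := by
    rw [sub_apply, inner_sub_left]
  simp only [h]
  calc ‖(inner ℝ ((B x - A x) (ξ x)) (η x) : ℝ)‖ ≤ ‖(B x - A x) (ξ x)‖ * ‖η x‖ :=
        norm_inner_le_norm _ _
    _ ≤ ‖B x - A x‖ * ‖ξ x‖ * ‖η x‖ := by gcongr; exact (B x - A x).le_opNorm _
    _ ≤ ε * ‖ξ x‖ * ‖η x‖ := by gcongr; rw [norm_sub_rev]; exact hAB x
    _ = ε * (‖ξ x‖ * ‖η x‖) := by ring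

/-- Stability of the minimum of a quadratic energy. The minimiser `W₀` of the energy `A` and the
minimiser `W` of the nearby energy `B`, over the same affine space of fields, have almost the same
energy `B`: the difference is of second order in the distance of the two energies. -/
theorem abs_energy_sub_le {A B : X → E3 →L[ℝ] E3} (hA : Continuous A) (hB : Continuous B)
    {ε : ℝ} (hε : ε ≤ 1 / 4) (hAB : ∀ x, ‖A x - B x‖ ≤ ε)
    (hsymm : ∀ x ξ η, (inner ℝ (B x ξ) η : ℝ) = inner ℝ (B x η) ξ)
    {W W₀ : X → E3} (hW : MemLp W 2 μ) (hW₀ : MemLp W₀ 2 μ)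
    (hid : ∀ x, inner ℝ (A x (W x - W₀ x)) (W x - W₀ x) = ‖W x - W₀ x‖ ^ 2)
    (h₀ : ∫ x, inner ℝ (A x (W₀ x)) (W x - W₀ x) ∂μ = 0)
    (h : ∫ x, inner ℝ (B x (W x)) (W x - W₀ x) ∂μ = 0) :
    |∫ x, inner ℝ (B x (W x)) (W x) ∂μ - ∫ x, inner ℝ (B x (W₀ x)) (W₀ x) ∂μ| ≤
      2 * (∫ x, ‖W₀ x‖ ^ 2 ∂μ) * ε ^ 2 := by
  have hD : MemLp (fun x => W x - W₀ x) 2 μ := hW.sub hW₀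
  have hWD := integrable_inner_clm_apply hB hW hD
  have hW₀D := integrable_inner_clm_apply hB hW₀ hD
  have hW₀W₀ := integrable_inner_clm_apply hB hW₀ hW₀
  have hDD := integrable_inner_clm_apply hB hD hD
  -- with `D = W - W₀`, the energy `B` of `W` exceeds that of `W₀` by `∫ B W₀ · D`
  have i1 : ∫ x, inner ℝ (B x (W x)) (W x) ∂μ = ∫ x, inner ℝ (B x (W x)) (W x - W₀ x) ∂μ +
      ∫ x, inner ℝ (B x (W₀ x)) (W x - W₀ x) ∂μ + ∫ x, inner ℝ (B x (W₀ x)) (W₀ x) ∂μ := by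
    have hsum : Integrable (fun x => (inner ℝ (B x (W x)) (W x - W₀ x) : ℝ) +
        inner ℝ (B x (W₀ x)) (W x - W₀ x)) μ := hWD.add hW₀D
    rw [← integral_add hWD hW₀D, ← integral_add hsum hW₀W₀]
    refine integral_congr_ae (.of_forall fun x => ?_)
    simp only [inner_sub_right]
    linarith [hsymm x (W x) (W₀ x)]
  have i2 : ∫ x, inner ℝ (B x (W x)) (W x - W₀ x) ∂μ =
      ∫ x, inner ℝ (B x (W₀ x)) (W x - W₀ x) ∂μ +
      ∫ x, inner ℝ (B x (W x - W₀ x)) (W x - W₀ x) ∂μ := by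
    rw [← integral_add hW₀D hDD]
    refine integral_congr_ae (.of_forall fun x => ?_)
    simp only [map_sub, inner_sub_left]
    ring
  -- `∫ B W₀ · D` is small since `∫ A W₀ · D` vanishes, and `∫ |D|²` is nearly `-∫ B W₀ · D`
  have i3 := abs_integral_inner_sub_le hA hB hAB hW₀ hD
  have i4 := abs_integral_inner_sub_le hA hB hAB hD hD
  have e2 : Integrable (fun x => ‖W₀ x‖ ^ 2) μ := hW₀.norm.integrable_sq
  have d2 : Integrable (fun x => ‖W x - W₀ x‖ ^ 2) μ := hD.norm.integrable_sq
  have i5 : ∫ x, ε * (‖W₀ x‖ * ‖W x - W₀ x‖) ∂μ ≤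
      ε ^ 2 * (∫ x, ‖W₀ x‖ ^ 2 ∂μ) + 1 / 4 * ∫ x, ‖W x - W₀ x‖ ^ 2 ∂μ := by
    rw [← integral_const_mul, ← integral_const_mul,
      ← integral_add (e2.const_mul _) (d2.const_mul _)]
    refine integral_mono ((hW₀.norm.integrable_mul hD.norm).const_mul ε)
      ((e2.const_mul _).add (d2.const_mul _)) fun x => ?_
    simp only
    nlinarith [sq_nonneg (ε * ‖W₀ x‖ - 1 / 2 * ‖W x - W₀ x‖)]
  have i6 : ∫ x, ε * (‖W x - W₀ x‖ * ‖W x - W₀ x‖) ∂μ = ε * ∫ x, ‖W x - W₀ x‖ ^ 2 ∂μ := by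
    rw [← integral_const_mul]
    simp only [sq]
  have i7 : ∫ x, inner ℝ (A x (W x - W₀ x)) (W x - W₀ x) ∂μ = ∫ x, ‖W x - W₀ x‖ ^ 2 ∂μ :=
    integral_congr_ae (.of_forall hid)
  have hd0 : 0 ≤ ∫ x, ‖W x - W₀ x‖ ^ 2 ∂μ := integral_nonneg fun x => sq_nonneg _
  rw [h₀, sub_zero] at i3
  rw [i6, i7] at i4
  rw [i1, h, zero_add, add_sub_cancel_right]
  rw [h] at i2
  generalize ∫ x, ‖W x - W₀ x‖ ^ 2 ∂μ = d at *
  have hεd : ε * d ≤ 1 / 4 * d := mul_le_mul_of_nonneg_right hε hd0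
  have := abs_le.1 i3
  have := abs_le.1 i4
  rw [abs_le]
  constructor <;> linarith

/-- The derivative of the energy of a fixed `1`-form on a moving surface. -/
theorem hasDerivAt_integral_of_lipschitz {A : ℝ → X → E3 →L[ℝ] E3} {s : Set ℝ}
    {t₀ : ℝ} (hs : s ∈ 𝓝 t₀) (hA : ∀ t ∈ s, Continuous (A t)) {C : NNReal}
    (hC : ∀ x, LipschitzOnWith C (fun t => A t x) s) {W : X → E3} (hW : MemLp W 2 μ) {F' : X → ℝ}
    (hF' : ∀ x, HasDerivAt (fun t => inner ℝ (A t x (W x)) (W x)) (F' x) t₀) :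
    Integrable F' μ ∧ HasDerivAt (fun t => ∫ x, inner ℝ (A t x (W x)) (W x) ∂μ)
      (∫ x, F' x ∂μ) t₀ := by
  have hint : ∀ t ∈ s, Integrable (fun x => (inner ℝ (A t x (W x)) (W x) : ℝ)) μ :=
    fun t ht => integrable_inner_clm_apply (hA t ht) hW hW
  have ht₀ := mem_of_mem_nhds hs
  refine hasDerivAt_integral_of_dominated_loc_of_lip (bound := fun x => C * ‖W x‖ ^ 2) hs ?_
    (hint t₀ ht₀) ?_ ?_ (hW.norm.integrable_sq.const_mul _) (.of_forall hF')
  · filter_upwards [hs] with t ht using (hint t ht).aestronglyMeasurable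
  -- `F'` is measurable as a limit of difference quotients
  · classical
    refine aestronglyMeasurable_of_tendsto_ae (𝓝[≠] t₀) (f := fun t x => if t ∈ s then
      slope (fun t => (inner ℝ (A t x (W x)) (W x) : ℝ)) t₀ t else 0) (fun t => ?_)
      (.of_forall fun x => ?_)
    · by_cases ht : t ∈ s
      · simp only [ht, if_true, slope_def_module]
        exact ((hint t ht).sub (hint t₀ ht₀)).aestronglyMeasurable.const_smul (t - t₀)⁻¹
      · simp only [ht, if_false]
        exact aestronglyMeasurable_const
    · refine (hasDerivAt_iff_tendsto_slope.1 (hF' x)).congr' ?_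
      filter_upwards [mem_nhdsWithin_of_mem_nhds hs] with t ht
      simp only [ht, if_true]
  · refine .of_forall fun x => LipschitzOnWith.of_dist_le_mul fun t ht t' ht' => ?_
    have h1 := (hC x).dist_le_mul t ht t' ht'
    rw [dist_eq_norm] at h1
    rw [Real.coe_nnabs, abs_of_nonneg (by positivity), dist_eq_norm, ← inner_sub_left, ← sub_apply]
    calc ‖(inner ℝ ((A t x - A t' x) (W x)) (W x) : ℝ)‖
        ≤ ‖(A t x - A t' x) (W x)‖ * ‖W x‖ := norm_inner_le_norm _ _
      _ ≤ ‖A t x - A t' x‖ * ‖W x‖ * ‖W x‖ := by gcongr; exact (A t x - A t' x).le_opNorm _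
      _ ≤ C * dist t t' * ‖W x‖ * ‖W x‖ := by gcongr
      _ = C * ‖W x‖ ^ 2 * dist t t' := by ring

end Perturbation

/-! ### The weak equation on a fixed surface -/

section Transport

variable {M : Type*} [TopologicalSpace M] [ChartedSpace E2 M]

/-- The total field `G + p_tan` on `g`, transported to `f` as a `1`-form on `M`. -/
def totalField (f g : M → T3) (p : E3) (G : M → E3) (x : M) : E3 :=
  transfer g f x (G x + tangentPart g p x)

theorem tangentPart_mem (f : M → T3) (p : E3) (x : M) : tangentPart f p x ∈ tangentPlane f x :=
  Submodule.starProjection_apply_mem _ _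

variable [IsManifold (𝓡 2) ∞ M] {f g : M → T3}

theorem totalField_self (hf : IsEmbeddedSurface f) {p : E3} {G : M → E3}
    (hG : ∀ x, G x ∈ tangentPlane f x) (x : M) :
    totalField f f p G x = G x + tangentPart f p x :=
  transfer_self_of_mem hf (Submodule.add_mem _ (hG x) (tangentPart_mem f p x))

theorem transfer_totalField (hf : IsEmbeddedSurface f) (hg : IsEmbeddedSurface g) {p : E3}
    {G : M → E3} (hG : ∀ x, G x ∈ tangentPlane g x) (x : M) :
    transfer f g x (totalField f g p G x) = G x + tangentPart g p x := by
  rw [totalField, transfer_transfer hg hf hg, transfer_self_of_mem hg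
    (Submodule.add_mem _ (hG x) (tangentPart_mem g p x))]

variable [CompactSpace M] [MeasurableSpace M] [BorelSpace M]

theorem integral_area_eq (hf : IsEmbeddedSurface f) (hg : IsEmbeddedSurface g) (F : M → ℝ) :
    ∫ x, F x ∂(area g) = ∫ x, areaRatio f g x * F x ∂(area f) := by
  rw [area_eq_withDensity hf hg, integral_withDensity_eq_integral_toReal_smul
    (continuous_areaRatio hf hg).measurable.ennreal_ofReal
    (.of_forall fun _ => ENNReal.ofReal_lt_top)]
  simp only [ENNReal.toReal_ofReal (areaRatio_pos hf hg _).le, smul_eq_mul]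

theorem IsH1.memLp_totalField (hf : IsEmbeddedSurface f) (hg : IsEmbeddedSurface g) (p : E3)
    {u : M → ℝ} {G : M → E3} (h : IsH1 g u G) : MemLp (totalField f g p G) 2 (area f) := by
  have := hg.isFiniteMeasure_area
  refine memLp_transfer hg hf (memLp_area hg hf (h.memLpGrad.add ?_))
  rw [funext (tangentPart_eq_transfer hg p)]
  exact memLp_two_of_continuous ((continuous_transfer hg hg).clm_apply continuous_const)

/-- The weak equation on `g`, transported to `f`. -/
theorem IsWeakSolution.integral_energyForm_eq_zero (hf : IsEmbeddedSurface f)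
    (hg : IsEmbeddedSurface g) {p : E3} {u : M → ℝ} {G : M → E3} (h : IsWeakSolution g p u G)
    {v : M → ℝ} {D : M → E3} (hD : IsH1 f v D) :
    ∫ x, inner ℝ (energyForm f g x (totalField f g p G x)) (D x) ∂(area f) = 0 := by
  rw [← h.2 v _ (hD.transfer hf hg), integral_area_eq hf hg]
  simp only [inner_energyForm hg, transfer_totalField hf hg h.1.weakGradient.tangential]

theorem IsWeakSolution.numerator_eq (hf : IsEmbeddedSurface f) (hg : IsEmbeddedSurface g)
    {p : E3} {u : M → ℝ} {G : M → E3} (h : IsWeakSolution g p u G) (κ : ℝ) :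
    numerator κ p g G = κ * ∫ x, inner ℝ (energyForm f g x (totalField f g p G x))
      (totalField f g p G x) ∂(area f) := by
  rw [numerator, integral_const_mul, integral_area_eq hf hg]
  simp only [inner_energyForm hg, transfer_totalField hf hg h.1.weakGradient.tangential]

/-- A field orthogonal to all gradients is orthogonal to the difference of two total fields,
because the `1`-forms induced by `p` on two nearby surfaces differ by an exact form. -/
theorem integral_inner_totalField_sub_eq_zero (hf : IsEmbeddedSurface f)
    (hg : IsEmbeddedSurface g) {p : E3} (hfg : ∀ x, ‖lift (f x) (g x)‖ < 1 / 4)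
    {u u₀ : M → ℝ} {G G₀ : M → E3} (hu : IsH1 g u G) (hu₀ : IsH1 f u₀ G₀) {Z : M → E3}
    (hZ : MemLp Z 2 (area f))
    (h : ∀ (v : M → ℝ) (D : M → E3), IsH1 f v D → ∫ x, inner ℝ (Z x) (D x) ∂(area f) = 0) :
    ∫ x, inner ℝ (Z x) (totalField f g p G x - totalField f f p G₀ x) ∂(area f) = 0 := by
  have h1 := hu.transfer hg hf
  have h2 := isH1_displacement hf hg p hfg
  have i1 := integrable_inner_of_memLp hZ h1.memLpGrad
  have i2 := integrable_inner_of_memLp hZ hu₀.memLpGrad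
  have i3 := integrable_inner_of_memLp hZ h2.memLpGrad
  have key : ∫ x, inner ℝ (Z x) (totalField f g p G x - totalField f f p G₀ x) ∂(area f) =
      ∫ x, inner ℝ (Z x) (transfer g f x (G x)) ∂(area f) - ∫ x, inner ℝ (Z x) (G₀ x) ∂(area f) +
        ∫ x, inner ℝ (Z x) (transfer g f x p - transfer f f x p) ∂(area f) := by
    have i4 : Integrable (fun x => (inner ℝ (Z x) (transfer g f x (G x)) : ℝ) -
        inner ℝ (Z x) (G₀ x)) (area f) := i1.sub i2
    rw [← integral_sub i1 i2, ← integral_add i4 i3]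
    refine integral_congr_ae (.of_forall fun x => ?_)
    simp only [totalField, map_add, tangentPart_eq_transfer hg, tangentPart_eq_transfer hf,
      transfer_transfer hg hg hf, transfer_transfer hf hf hf,
      transfer_self_of_mem hf (hu₀.weakGradient.tangential x), inner_sub_right, inner_add_right]
    ring
  rw [key, h _ _ h1, h _ _ hu₀, h _ _ h2]
  norm_num

/-- The energy of the solution on `g` differs from the energy, with respect to `g`, of the solution
on `f` only to second order in the distance of the energy forms. -/
theorem IsWeakSolution.abs_energy_sub_le (hf : IsEmbeddedSurface f) (hg : IsEmbeddedSurface g)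
    {p : E3} (hfg : ∀ x, ‖lift (f x) (g x)‖ < 1 / 4) {u u₀ : M → ℝ} {G G₀ : M → E3}
    (h : IsWeakSolution g p u G) (h₀ : IsWeakSolution f p u₀ G₀) {ε : ℝ}
    (hε : ε ≤ 1 / 4) (hE : ∀ x, ‖energyForm f f x - energyForm f g x‖ ≤ ε) :
    |∫ x, inner ℝ (energyForm f g x (totalField f g p G x)) (totalField f g p G x) ∂(area f) -
      ∫ x, inner ℝ (energyForm f g x (totalField f f p G₀ x)) (totalField f f p G₀ x) ∂(area f)| ≤
      2 * (∫ x, ‖totalField f f p G₀ x‖ ^ 2 ∂(area f)) * ε ^ 2 := by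
  have hA := continuous_energyForm hf hf
  have hB := continuous_energyForm hf hg
  have hW := h.1.memLp_totalField hf hg p
  have hW₀ := h₀.1.memLp_totalField hf hf p
  refine ADC.abs_energy_sub_le hA hB hε hE (fun x ξ η => ?_) hW hW₀ (fun x => ?_) ?_ ?_
  · rw [inner_energyForm hg, inner_energyForm hg, real_inner_comm]
  · have hm : totalField f g p G x - totalField f f p G₀ x ∈ tangentPlane f x :=
      Submodule.sub_mem _ (transfer_mem _ _ _ _) (transfer_mem _ _ _ _)
    rw [inner_energyForm_self hf hm hm, real_inner_self_eq_norm_sq]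
  · exact integral_inner_totalField_sub_eq_zero hf hg hfg h.1 h₀.1 (memLp_two_clm_apply hA hW₀)
      fun v D hD => h₀.integral_energyForm_eq_zero hf hf hD
  · exact integral_inner_totalField_sub_eq_zero hf hg hfg h.1 h₀.1 (memLp_two_clm_apply hB hW)
      fun v D hD => h.integral_energyForm_eq_zero hf hg hD

end Transport

end

end ADC

/-! ### The derivative of the energy -/

theorem proposition1 {M : Type*} [TopologicalSpace M] [T2Space M] [CompactSpace M]
    [ChartedSpace ADC.E2 M] [IsManifold (𝓡 2) ∞ M] [MeasurableSpace M] [BorelSpace M]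
    (κ : ℝ) (p : ADC.E3)
    -- the moving surface
    (t₁ t₂ : ℝ) (r : ℝ → M → ADC.T3)
    (hr : ADC.IsSmoothFamily (Ioo t₁ t₂) r)
    (hemb : ∀ t ∈ Ioo t₁ t₂, ADC.IsEmbeddedSurface (r t))
    -- at the time `t₀` its velocity is `v n`
    (t₀ : ℝ) (ht₀ : t₀ ∈ Ioo t₁ t₂) (n : M → ADC.E3) (hn : ADC.IsUnitNormal (r t₀) n)
    (v : M → ℝ)
    (hv : ∀ x, HasDerivAt (fun t => ADC.lift (r t₀ x) (r t x)) (v x • n x) t₀)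
    -- the solutions on the moving surface
    (u : ℝ → M → ℝ) (gradu : ℝ → M → ADC.E3)
    (hu : ∀ t ∈ Ioo t₁ t₂, ADC.IsWeakSolution (r t) p (u t) (gradu t)) :
    Integrable (ADC.sensitivityDensity κ p (r t₀) n v (gradu t₀)) (ADC.area (r t₀)) ∧
      HasDerivAt (fun t => ADC.numerator κ p (r t) (gradu t))
        (∫ x, ADC.sensitivityDensity κ p (r t₀) n v (gradu t₀) x ∂(ADC.area (r t₀))) t₀ := by
  have hJ : Ioo t₁ t₂ ∈ 𝓝 t₀ := isOpen_Ioo.mem_nhds ht₀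
  have hf := hemb t₀ ht₀
  have h₀ := hu t₀ ht₀
  obtain ⟨C, s, hs, hsJ, hC⟩ := hr.exists_lipschitz_energyForm hemb hJ
  set W := ADC.totalField (r t₀) (r t₀) p (gradu t₀)
  have hW : MemLp W 2 (ADC.area (r t₀)) := h₀.1.memLp_totalField hf hf p
  -- the energy of the `1`-form frozen at the time `t₀`
  obtain ⟨hint, hder⟩ := ADC.hasDerivAt_integral_of_lipschitz hs
    (fun t ht => ADC.continuous_energyForm hf (hemb t (hsJ ht))) hC hW
    fun x => hr.hasDerivAt_energyForm hJ hf hn hv x (ADC.transfer_mem _ _ _ _ : W x ∈ _)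
  have hdens : ADC.sensitivityDensity κ p (r t₀) n v (gradu t₀) = fun x => κ * (2 * v x *
      (ADC.secondFormQuad (r t₀) n x (W x) -
        ADC.meanCurv (r t₀) n x * inner ℝ (W x) (W x))) := by
    funext x
    rw [ADC.sensitivityDensity, ← ADC.totalField_self hf h₀.1.weakGradient.tangential]
    ring
  -- replacing the frozen `1`-form by the solution at the time `t` costs only `O((t - t₀)²)`
  have herr : HasDerivAt (fun t => ADC.numerator κ p (r t) (gradu t) -
      κ * ∫ x, inner ℝ (ADC.energyForm (r t₀) (r t) x (W x)) (W x) ∂(ADC.area (r t₀))) 0 t₀ := by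
    suffices h : (fun t => ADC.numerator κ p (r t) (gradu t) -
        κ * ∫ x, inner ℝ (ADC.energyForm (r t₀) (r t) x (W x)) (W x) ∂(ADC.area (r t₀)))
        =O[𝓝 t₀] fun t => ‖t - t₀‖ ^ 2 by
      simpa using (h.hasFDerivAt (𝕜 := ℝ) one_lt_two).hasDerivAt
    refine Asymptotics.IsBigO.of_bound
      (|κ| * (2 * (∫ x, ‖W x‖ ^ 2 ∂(ADC.area (r t₀))) * C ^ 2)) ?_
    have hsmall : ∀ᶠ t in 𝓝 t₀, C * dist t₀ t ≤ 1 / 4 := by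
      have h1 : Tendsto (fun t => C * dist t₀ t) (𝓝 t₀) (𝓝 (C * dist t₀ t₀)) :=
        (continuous_const.mul (continuous_const.dist continuous_id)).continuousAt
      rw [dist_self, mul_zero] at h1
      exact h1.eventually (ge_mem_nhds (by norm_num))
    filter_upwards [hs, hsmall, hr.eventually_norm_lift_lt ht₀] with t ht hsm hlift
    have hg := hemb t (hsJ ht)
    have h1 := (hu t (hsJ ht)).abs_energy_sub_le hf hg hlift h₀ hsm fun x => by
      simpa [dist_eq_norm] using (hC x).dist_le_mul t₀ (mem_of_mem_nhds hs) t ht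
    rw [(hu t (hsJ ht)).numerator_eq hf hg, ← mul_sub, norm_mul, Real.norm_eq_abs, mul_assoc]
    refine mul_le_mul_of_nonneg_left (h1.trans_eq ?_) (abs_nonneg κ)
    rw [dist_comm, dist_eq_norm, norm_pow, norm_norm]
    ring
  refine ⟨by rw [hdens]; exact hint.const_mul κ, ?_⟩
  rw [hdens, integral_const_mul]
  refine ((herr.add (hder.const_mul κ)).congr_deriv (zero_add _)).congr_of_eventuallyEq
    (.of_forall fun t => ?_)
  simp only [Pi.add_apply, sub_add_cancel]
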